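/- **Setting.** Let $d\in\mathbb N$, let $W=C([0,1],\mathbb R^d)$ with the uniform norm $|\cdot|_W$ and its Borel $\sigma$-field $\mathcal B(W)$, with evaluation process $W_t(\omega)=\omega(t)$ and identity map $I_W$. For a Borel probability $\eta$ on $W$, $\mathcal B(W)^\eta$ is the $\eta$-completion of $\mathcal B(W)$ and $(\mathcal F^\eta_t)_{t\in[0,1]}$ is the $\eta$-usual augmentation of the filtration generated by $(W_t)$. Let $H$ be the Hilbert space of all $h=\int_0^\cdot\dot h_s\,ds$ with $\dot h\in L^2([0,1];\mathbb R^d)$ and $\langle h,k\rangle_H=\int_0^1\langle\dot h_s,\dot k_s\rangle ds$, and let $H_{0,0}=\{h\in H: h_0=h_1=0\}$. $L^2_a(\eta,H)$ is the set of ($\eta$-a.s. classes of) $(\mathcal F_t^\eta)$-adapted $H$-valued random variables $h$ on $(W,\mathcal B(W)^\eta,\eta)$ with $\mathbb E_\eta[|h|_H^2]<\infty$, and $L^2_a(\eta,H_{0,0})$ is the subset of those with $h_0=h_1=0$ $\eta$-a.s. $\mathbb S$ is the set of Borel probabilities $\eta$ on $W$ under which $W_t=W_0+M_t+\int_0^t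 v_s\,ds$, where $M$ is a continuous $(\mathcal F^\eta_t)$-local martingale with $M_0=0$ and $\langle M\rangle=\int_0^\cdot\alpha_s\,ds$, where $v$ and $\alpha$ are measurable processes, integrable in time $\eta$-a.s., with $\int_0^\cdot v_s\,ds$ and $\int_0^\cdot\alpha_s\,ds$ adapted. A map $U:W\to W$ is an isomorphism of filtered probability spaces at $\eta$ if it is $\mathcal B(W)^\eta/\mathcal B(W)$-measurable and $(\mathcal F^\eta_t)$-adapted and has a $\mathcal B(W)^{U_\star\eta}/\mathcal B(W)$-measurable, $(\mathcal F^{U_\star\eta}_t)$-adapted inverse $\widetilde U$, i.e. $\widetilde U\circ U=I_W$ $\eta$-a.s. and $U\circ\widetilde U=I_W$ $U_\star\eta$-a.s. Let $\mathcal I_f^0(\eta)$ be the set of those with $\sigma(U_0)^\eta=\sigma(W_0)^\eta$ ($\eta$-completed $\sigma$-fields). Let $V_\eta=\{h\in L^2_a(\eta,H): U+h\in\mathcal I^0_f(\eta)\text{ for all }U\in\mathcal I^0_f(\eta)\}$ and let $V_\eta^{0,\infty}$ be the set of $h\in V_\eta$ with $h_0=h_1=0$ $\eta$-a.s. and $|h|_W\le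 C$ $\eta$-a.s. for some constant $C>0$. A functional $\mathcal S:\mathbb S\to[0,+\infty]$ is $L^2_a(\eta,H_{0,0})$-differentiable at $\eta\in\mathbb S$ if $\mathcal S(\eta)<\infty$ and there is $\xi_0\in L^2_a(\eta,H_{0,0})$ such that for every $k\in V_\eta^{0,\infty}$ the derivative $\frac{d}{d\epsilon}\mathcal S\big((I_W+\epsilon k)_\star\eta\big)\big|_{\epsilon=0}$ exists and equals $\mathbb E_\eta[\langle\xi_0,k\rangle_H]$. One then sets $\delta\mathcal S_\eta[k]=\mathbb E_\eta[\langle\xi_0,k\rangle_H]$ for $k\in L^2_a(\eta,H_{0,0})$. **Lemma.** Let $\nu\in\mathbb S$, let $\mathcal S:\mathbb S\to[0,+\infty]$ be $L^2_a(\nu,H_{0,0})$-differentiable at $\nu$, and let $\xi\in L^2_a(\nu,H)$ be such that $\delta\mathcal S_\nu[h]=\mathbb E_\nu[\langle\xi,h\rangle_H]$ for all $h\in V_\nu^{0,\infty}$. Then the following are equivalent. 1. $\delta\mathcal S_\nu[h]=0$ for all $h\in L^2_a(\nu,H)$ with $h_0=h_1=0$ $\nu$-a.s. and $\mathbb E_\nu[h]=0_H$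 (Bochner integral in $H$). 2. There are a càdlàg $(\mathcal F^\nu_t)$-martingale $(N_t)_{t\in[0,1)}$ on $(W,\mathcal B(W)^\nu,\nu)$, with $\int_0^1|N_s|\,ds<\infty$ $\nu$-a.s., and a deterministic measurable $A:[0,1]\to\mathbb R^d$ with $\int_0^1|A_s|^2ds<\infty$, such that, $\nu$-a.s., $\xi=\int_0^\cdot A_s\,ds+\int_0^\cdot N_s\,ds$. -/

import Mathlib

open MeasureTheory Filter Topology ProbabilityTheory unitInterval

noncomputable section

namespace PathVariation

/-! ### Path space and Cameron-Martin space -/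

/-- `ℝ^d` with its Euclidean norm. -/
abbrev Euc (d : ℕ) := EuclideanSpace ℝ (Fin d)

/-- The path space `W = C([0,1], ℝ^d)` with the norm of uniform convergence. -/
abbrev PathSpace (d : ℕ) := C(I, Euc d)

/-- The Borel sigma-field of `W`. -/
instance (d : ℕ) : MeasurableSpace (PathSpace d) := borel (PathSpace d)

instance (d : ℕ) : BorelSpace (PathSpace d) := ⟨rfl⟩

/-- The Cameron-Martin space `H`. An element `h = ∫₀^· ḣ_s ds` is stored as its density
`ḣ ∈ L²([0,1], ℝ^d)` (up to almost everywhere equality), so that the Hilbert structure is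
`⟨h, k⟩_H = ∫₀¹ ⟨ḣ_s, k̇_s⟩ ds`. The path `h` itself is `cmPath h`. -/
abbrev CameronMartin (d : ℕ) := Lp (Euc d) 2 (volume : Measure I)

lemma cm_integrable {d : ℕ} (h : CameronMartin d) :
    Integrable (h : I → Euc d) (volume : Measure I) :=
  (Lp.memLp h).integrable (by norm_num)

lemma cm_continuous_primitive {d : ℕ} (h : CameronMartin d) :
    Continuous fun t : I => ∫ s in Set.Iic t, h s := by
  rw [continuous_iff_continuousAt]
  intro t₀
  simp_rw [← integral_indicator measurableSet_Iic]
  refine continuousAt_of_dominated (bound := fun s => ‖h s‖) ?_ ?_ (cm_integrable h).norm ?_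
  · exact .of_forall fun t => ((cm_integrable h).indicator measurableSet_Iic).aestronglyMeasurable
  · exact .of_forall fun t => .of_forall fun s => norm_indicator_le_norm_self _ _
  · have h0 : ∀ᵐ s : I, s ≠ t₀ := by simp [ae_iff]
    filter_upwards [h0] with s hs
    rcases lt_or_gt_of_ne hs with hlt | hgt
    · refine (continuousAt_const (y := h s)).congr ?_
      filter_upwards [lt_mem_nhds hlt] with t ht
      exact (Set.indicator_of_mem (Set.mem_Iic.2 ht.le) _).symm
    · refine (continuousAt_const (y := (0 : Euc d))).congr ?_
      filter_upwards [gt_mem_nhds hgt] with t ht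
      exact (Set.indicator_of_notMem (by simpa using ht) _).symm

/-- The path `t ↦ ∫₀^t ḣ_s ds` of an element of `H`. -/
def cmPath {d : ℕ} (h : CameronMartin d) : PathSpace d :=
  ⟨fun t => ∫ s in Set.Iic t, h s, cm_continuous_primitive h⟩

/-! ### The completed probability space and the filtration -/

/-- The `η`-completion `𝓑(W)^η` of the Borel sigma-field. -/
@[reducible] def completedBorel {d : ℕ} (η : Measure (PathSpace d)) : MeasurableSpace (PathSpace d) :=
  NullMeasurableSpace.instMeasurableSpace (μ := η)

/-- The measure `η` on `𝓑(W)^η`. -/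
def completed {d : ℕ} (η : Measure (PathSpace d)) : @Measure (PathSpace d) (completedBorel η) :=
  η.completion

/-- The sigma-field generated by the `η`-negligible sets. -/
@[reducible] def nullField {d : ℕ} (η : Measure (PathSpace d)) : MeasurableSpace (PathSpace d) :=
  MeasurableSpace.generateFrom {A | η A = 0}

lemma nullField_le {d : ℕ} (η : Measure (PathSpace d)) : nullField η ≤ completedBorel η :=
  MeasurableSpace.generateFrom_le fun _ hA => NullMeasurableSet.of_null hA

lemma borel_le_completedBorel {d : ℕ} (η : Measure (PathSpace d)) :
    (inferInstance : MeasurableSpace (PathSpace d)) ≤ completedBorel η :=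
  fun _ hs => MeasurableSet.nullMeasurableSet hs

lemma stronglyMeasurable_eval {d : ℕ} (η : Measure (PathSpace d)) (t : I) :
    StronglyMeasurable[completedBorel η] fun ω : PathSpace d => ω t :=
  ((continuous_eval_const t).stronglyMeasurable).mono (borel_le_completedBorel η)

/-- The filtration `(𝓕_t^η)`: the `η`-usual augmentation (completion by all negligible sets, then
right-continuous regularization) of the filtration generated by the evaluation process. -/
def usualFiltration {d : ℕ} (η : Measure (PathSpace d)) : Filtration I (completedBorel η) :=
  (Filtration.natural (m := completedBorel η) (fun (t : I) (ω : PathSpace d) => ω t)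
      (stronglyMeasurable_eval η) ⊔
    Filtration.const I (nullField η) (nullField_le η)).rightCont

/-- The restriction of a filtration on `[0,1]` to the time set `[0,1)`. -/
def beforeOne {Ω : Type*} {m : MeasurableSpace Ω} (𝓕 : Filtration I m) :
    Filtration (Set.Iio (1 : I)) m where
  seq t := 𝓕 t
  mono' _ _ hst := 𝓕.mono hst
  le' t := 𝓕.le t

/-! ### Laws of continuous semimartingales -/

/-- Real-valued local martingales with respect to `(𝓕_t^η)`. -/
def IsLocalMartingale {d : ℕ} (η : Measure (PathSpace d)) (X : I → PathSpace d → ℝ) : Prop :=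
  Locally (fun Y => Martingale Y (usualFiltration η) (completed η)) (usualFiltration η) X
    (completed η)

/-- `M` is a continuous local martingale vanishing at `0` (the martingale part), `v` the drift
characteristic and `α` the dispersion characteristic of `η`: `W_t = W_0 + M_t + ∫₀^t v_s ds` and
`⟨M⟩ = ∫₀^· α_s ds`. The bracket is expressed by its defining property: it is the adapted
continuous process of finite variation, null at `0`, such that `Mⁱ Mʲ - ⟨Mⁱ, Mʲ⟩` is a local
martingale. -/
structure IsSemimartingaleDecomposition {d : ℕ} (η : Measure (PathSpace d)) (M v : I → PathSpace d → Euc d)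
    (α : Fin d → Fin d → I → PathSpace d → ℝ) : Prop where
  continuous_M : ∀ᵐ ω ∂(completed η), Continuous fun t => M t ω
  M_zero : ∀ᵐ ω ∂(completed η), M 0 ω = 0
  localMartingale_M : ∀ i, IsLocalMartingale η fun t ω => M t ω i
  measurable_v : Measurable[@Prod.instMeasurableSpace _ _ _ (completedBorel η)]
    fun p : I × PathSpace d => v p.1 p.2
  integrable_v : ∀ᵐ ω ∂(completed η), Integrable (fun s => v s ω) (volume : Measure I)
  adapted_drift : ∀ t, Measurable[usualFiltration η t] fun ω => ∫ s in Set.Iic t, v s ω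
  decomposition : ∀ᵐ ω ∂(completed η), ∀ t : I, ω t = ω 0 + M t ω + ∫ s in Set.Iic t, v s ω
  measurable_α : ∀ i j, Measurable[@Prod.instMeasurableSpace _ _ _ (completedBorel η)]
    fun p : I × PathSpace d => α i j p.1 p.2
  integrable_α : ∀ i j, ∀ᵐ ω ∂(completed η), Integrable (fun s => α i j s ω) (volume : Measure I)
  adapted_bracket : ∀ i j t, Measurable[usualFiltration η t] fun ω => ∫ s in Set.Iic t, α i j s ω
  bracket : ∀ i j, IsLocalMartingale η fun t ω =>
    M t ω i * M t ω j - ∫ s in Set.Iic t, α i j s ω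

/-- The set `𝕊` of laws of continuous semimartingales with absolutely continuous
characteristics. -/
def SemimartingaleLaws (d : ℕ) : Set (Measure (PathSpace d)) :=
  {η | IsProbabilityMeasure η ∧ ∃ M v α, IsSemimartingaleDecomposition η M v α}

/-! ### Adapted Cameron-Martin valued processes and variation processes -/

/-- `h ∈ L²_a(η, H)`: a square integrable `H`-valued random variable whose path is
`(𝓕_t^η)`-adapted. Random variables are functions, to be considered up to `η`-almost sure
equality. -/
structure IsAdaptedL2 {d : ℕ} (η : Measure (PathSpace d)) (h : PathSpace d → CameronMartin d) : Prop where
  memLp : MemLp h 2 (completed η)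
  adapted : ∀ t : I, Measurable[usualFiltration η t] fun ω => cmPath (h ω) t

/-- `h_0 = h_1 = 0` almost surely. -/
def VanishesAtEnds {d : ℕ} (η : Measure (PathSpace d)) (h : PathSpace d → CameronMartin d) : Prop :=
  ∀ᵐ ω ∂(completed η), cmPath (h ω) 0 = 0 ∧ cmPath (h ω) 1 = 0

/-- The pairing `𝔼_η[⟨ξ, h⟩_H]`. -/
def pairing {d : ℕ} (η : Measure (PathSpace d)) (ξ h : PathSpace d → CameronMartin d) : ℝ :=
  ∫ ω, inner ℝ (ξ ω) (h ω) ∂(completed η)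

/-- `U : W → W` is `𝓑(W)^η / 𝓑(W)` measurable and `(𝓕_t^η)`-adapted. -/
structure IsAdaptedMap {d : ℕ} (η : Measure (PathSpace d)) (U : PathSpace d → PathSpace d) : Prop where
  measurable : @Measurable _ _ (completedBorel η) inferInstance U
  adapted : ∀ t : I, Measurable[usualFiltration η t] fun ω => U ω t

/-- The direct image `U_⋆ η`. -/
def push {d : ℕ} (η : Measure (PathSpace d)) (U : PathSpace d → PathSpace d) : Measure (PathSpace d) :=
  @Measure.map _ _ (completedBorel η) inferInstance U (completed η)

/-- `U` is an isomorphism of filtered probability spaces: it is adapted and has an adapted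
inverse. -/
def IsFilteredIso {d : ℕ} (η : Measure (PathSpace d)) (U : PathSpace d → PathSpace d) : Prop :=
  IsAdaptedMap η U ∧ ∃ V : PathSpace d → PathSpace d, IsAdaptedMap (push η U) V ∧
    (∀ᵐ ω ∂(completed η), V (U ω) = ω) ∧ ∀ᵐ ω ∂(completed (push η U)), U (V ω) = ω

/-- The `η`-completed sigma-field `σ(U_0)^η`. -/
@[reducible] def initialField {d : ℕ} (η : Measure (PathSpace d)) (U : PathSpace d → PathSpace d) : MeasurableSpace (PathSpace d) :=
  MeasurableSpace.comap (fun ω => U ω 0) inferInstance ⊔ nullField η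

/-- `U ∈ 𝓘_f^0(η)`: an isomorphism of filtered probability spaces such that
`σ(W_0)^η = σ(U_0)^η`. -/
def IsInitialIso {d : ℕ} (η : Measure (PathSpace d)) (U : PathSpace d → PathSpace d) : Prop :=
  IsFilteredIso η U ∧ initialField η id = initialField η U

/-- `h ∈ V_η`, the variation processes at `η`. -/
def IsVariation {d : ℕ} (η : Measure (PathSpace d)) (h : PathSpace d → CameronMartin d) : Prop :=
  IsAdaptedL2 η h ∧
    ∀ U, IsInitialIso η U → IsInitialIso η fun ω => U ω + cmPath (h ω)

/-- `h ∈ V_η^{0,∞}`: the variation processes which are bounded and vanish at both ends. -/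
def IsBoundedVariationZero {d : ℕ} (η : Measure (PathSpace d)) (h : PathSpace d → CameronMartin d) : Prop :=
  IsVariation η h ∧ (∃ C > 0, ∀ᵐ ω ∂(completed η), ‖cmPath (h ω)‖ ≤ C) ∧ VanishesAtEnds η h

/-! ### The intrinsic differential -/

/-- The perturbed law `η^{εk} = (I_W + ε k)_⋆ η`. -/
def perturb {d : ℕ} (η : Measure (PathSpace d)) (k : PathSpace d → CameronMartin d) (ε : ℝ) :
    Measure (PathSpace d) :=
  push η fun ω => ω + ε • cmPath (k ω)

open scoped Classical in
/-- A functional on `𝕊`, extended by `+∞` to all measures. -/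
def extend {d : ℕ} (S : SemimartingaleLaws d → ENNReal) (η : Measure (PathSpace d)) : ENNReal :=
  if h : η ∈ SemimartingaleLaws d then S ⟨η, h⟩ else ⊤

/-- `ε ↦ S(η^{εk})` is finite near `0` and has derivative `c` at `ε = 0`. -/
def HasVariationalDeriv {d : ℕ} (S : SemimartingaleLaws d → ENNReal) (η : Measure (PathSpace d))
    (k : PathSpace d → CameronMartin d) (c : ℝ) : Prop :=
  (∀ᶠ ε in 𝓝 (0 : ℝ), extend S (perturb η k ε) ≠ ⊤) ∧
    HasDerivAt (fun ε => (extend S (perturb η k ε)).toReal) c 0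

/-- `ξ ∈ L²_a(η, H_{0,0})` represents the derivatives of `S` at `η` in all the directions of
`V_η^{0,∞}`. -/
def IsGradient {d : ℕ} (S : SemimartingaleLaws d → ENNReal) (η : Measure (PathSpace d))
    (ξ : PathSpace d → CameronMartin d) : Prop :=
  IsAdaptedL2 η ξ ∧ VanishesAtEnds η ξ ∧
    ∀ k, IsBoundedVariationZero η k → HasVariationalDeriv S η k (pairing η ξ k)

/-- `S` is `L²_a(η, H_{0,0})`-differentiable at `η`, where `η ∈ 𝕊` and `S(η) < +∞`. -/
def IsDifferentiable {d : ℕ} (S : SemimartingaleLaws d → ENNReal)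
    (η : Measure (PathSpace d)) : Prop :=
  extend S η ≠ ⊤ ∧ ∃ ξ, IsGradient S η ξ

open scoped Classical in
/-- The differential `δS_η`, a functional of `k ∈ L²_a(η, H_{0,0})`; it is `0` by convention if `S`
is not differentiable at `η`. -/
def differential {d : ℕ} (S : SemimartingaleLaws d → ENNReal) (η : Measure (PathSpace d))
    (k : PathSpace d → CameronMartin d) : ℝ :=
  if h : IsDifferentiable S η then pairing η h.2.choose k else 0

/-! ### Càdlàg martingales -/

/-- `(N_t)_{t ∈ [0,1)}` is a càdlàg `(𝓕_t^η)`-martingale on `(W, 𝓑(W)^η, η)`. The value of `N` at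
time `1` plays no role. -/
structure IsCadlagMartingale {d : ℕ} (η : Measure (PathSpace d)) (N : I → PathSpace d → Euc d) : Prop where
  martingale : Martingale (fun t : Set.Iio (1 : I) => N t) (beforeOne (usualFiltration η))
    (completed η)
  rightContinuous : ∀ ω, ∀ t < (1 : I), ContinuousWithinAt (fun s => N s ω) (Set.Ici t) t
  leftLimits : ∀ ω, ∀ t < (1 : I), ∃ l, Tendsto (fun s => N s ω) (𝓝[<] t) (𝓝 l)

end PathVariation

end

open PathVariation

/-!
The heart of the matter is a property of a square integrable `H`-valued variable `ζ` with path `Z`: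
affine mean increments, `𝔼[Z_b - Z_s | 𝓕_s] = (b - s) / (1 - s) 𝔼[Z_1 - Z_s | 𝓕_s]`
(`HasAffineIncrements`). Three facts link it to the theorem.

* It follows from orthogonality of `ζ` to the elementary variations `1_B κ`, where `B` belongs to the
  past up to a time `s` and `κ` is a deterministic path which is zero up to some `a > s` and at time
  `1` (`hasAffineIncrements_of_orthogonal`; the paths `bumpPath` compare the mean slopes of `Z` on
  `B` over two disjoint intervals). These variations are bounded elements of `V^{0,∞}`
  (`isBoundedVariationZero_indicator`): because of the gap between `s` and `a`, the perturbed path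
  still determines whether `B` occurred before `κ` sets in, so `κ` can be subtracted again in an
  adapted way (`IsFilteredIso.add_indicator`).
* It implies orthogonality to every adapted `h` with `h_1 = 0`
  (`HasAffineIncrements.integral_inner_eq_zero`). The inner product of `H` is a limit of Riemann sums
  in which each increment of `h` meets an increment of `ζ` over the following cell, which affinity
  allows to replace by the last cell, so that the sum telescopes to `h_1`.
* For adapted `ζ` it is equivalent to having a càdlàg martingale as velocity. The velocity is
  `N_t = 𝔼[Z_1 - Z_t | 𝓕_t] / (1 - t)`, in the càdlàg version obtained from Doob's upcrossing and
  maximal inequalities (`Martingale.exists_cadlag_modification`), and it is the density of `Z` because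
  its Riemann sums converge to `Z` in mean square (`HasAffineIncrements.exists_martingale`). The
  converse is Fubini's theorem (`hasAffineIncrements_of_martingale`).

The first two facts, applied to the difference of `ξ` and the gradient in the definition of the
differential, give `δS_ν[h] = 𝔼⟨ξ, h⟩` for all adapted `h` that vanish at both ends
(`differential_eq_pairing`). The first condition of the theorem then says that `ξ` is orthogonal to
the centred directions, that is, that `ξ - 𝔼 ξ` is orthogonal to all of them. By the three facts this
means that `ξ - 𝔼 ξ` has a càdlàg martingale as velocity, and `A` is the velocity of `𝔼 ξ`.
-/

/-! ### Regularity of a path observed on the dyadic times -/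

/-- The dyadic times of `[0,1]` with denominator `2 ^ n`. -/
def dyadicLevel (n : ℕ) : Set I := {t | ∃ k : ℕ, (t : ℝ) = k / 2 ^ n}

/-- The dyadic times of `[0,1]`. -/
def dyadicTimes : Set I := ⋃ n, dyadicLevel n

lemma dyadicLevel_mono : Monotone dyadicLevel := by
  refine monotone_nat_of_le_succ fun n t => ?_
  rintro ⟨k, hk⟩
  refine ⟨2 * k, ?_⟩
  rw [hk, pow_succ]
  push_cast
  field_simp

lemma dense_dyadicTimes : Dense dyadicTimes := by
  refine dense_of_exists_between fun {u v} huv => ?_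
  have h0 : (0 : ℝ) < v - u := sub_pos.2 huv
  obtain ⟨n, hn⟩ := exists_pow_lt_of_lt_one h0 (by norm_num : (1 / 2 : ℝ) < 1)
  have hp : (0 : ℝ) < 2 ^ n := by positivity
  have hu : (0 : ℝ) ≤ u * 2 ^ n := mul_nonneg u.2.1 hp.le
  have h1 : (u : ℝ) < (⌊(u : ℝ) * 2 ^ n⌋₊ + 1 : ℕ) / 2 ^ n := by
    rw [lt_div_iff₀ hp]
    exact_mod_cast Nat.lt_floor_add_one _
  have h2 : ((⌊(u : ℝ) * 2 ^ n⌋₊ + 1 : ℕ) : ℝ) / 2 ^ n < v := by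
    have h3 : ((⌊(u : ℝ) * 2 ^ n⌋₊ + 1 : ℕ) : ℝ) / 2 ^ n ≤ u + (1 / 2) ^ n := by
      rw [div_le_iff₀ hp, add_mul, one_div, inv_pow, inv_mul_cancel₀ hp.ne']
      push_cast
      gcongr
      exact Nat.floor_le hu
    linarith
  exact ⟨⟨_, u.2.1.trans h1.le, h2.le.trans v.2.2⟩, Set.mem_iUnion.2 ⟨n, _, rfl⟩, h1, h2⟩

/-- The path `x` has at least `m` successive upcrossings of `[a, b]` at times of `D` after the
time `u`. -/
def HasUpcrossings (x : I → ℝ) (a b : ℝ) (D : Set I) : ℕ → I → Prop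
  | 0, _ => True
  | m + 1, u => ∃ p ∈ D, ∃ q ∈ D, u < p ∧ p < q ∧ x p < a ∧ b < x q ∧ HasUpcrossings x a b D m q

lemma HasUpcrossings.of_le {x : I → ℝ} {a b : ℝ} {D : Set I} {m : ℕ} {u v : I}
    (h : HasUpcrossings x a b D m u) (hvu : v ≤ u) : HasUpcrossings x a b D m v := by
  cases m with
  | zero => trivial
  | succ m =>
    obtain ⟨p, hp, q, hq, hup, h⟩ := h
    exact ⟨p, hp, q, hq, hvu.trans_lt hup, h⟩

lemma HasUpcrossings.mono {x : I → ℝ} {a b : ℝ} {D D' : Set I} (hD : D ⊆ D') {m : ℕ} {u : I}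
    (h : HasUpcrossings x a b D m u) : HasUpcrossings x a b D' m u := by
  induction m generalizing u with
  | zero => trivial
  | succ m ih =>
    obtain ⟨p, hp, q, hq, hup, hpq, ha, hb, h⟩ := h
    exact ⟨p, hD hp, q, hD hq, hup, hpq, ha, hb, ih h⟩

lemma HasUpcrossings.exists_level {x : I → ℝ} {a b : ℝ} {m : ℕ} {u : I}
    (h : HasUpcrossings x a b dyadicTimes m u) : ∃ n, HasUpcrossings x a b (dyadicLevel n) m u := by
  induction m generalizing u with
  | zero => exact ⟨0, trivial⟩
  | succ m ih =>
    obtain ⟨p, hp, q, hq, hup, hpq, ha, hb, h⟩ := h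
    obtain ⟨n, hn⟩ := ih h
    obtain ⟨i, hi⟩ := Set.mem_iUnion.1 hp
    obtain ⟨j, hj⟩ := Set.mem_iUnion.1 hq
    refine ⟨max n (max i j), p, dyadicLevel_mono (by simp) hi, q, dyadicLevel_mono (by simp) hj,
      hup, hpq, ha, hb, hn.mono (dyadicLevel_mono (by simp))⟩

/-- If `x` oscillates infinitely often across `[a, b]` at times decreasing to `t`, then it has
arbitrarily many upcrossings after `t`; they are collected backwards in time. -/
lemma hasUpcrossings_of_frequently_right {x : I → ℝ} {a b : ℝ} {D : Set I} {t : I}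
    (ha : ∃ᶠ s in 𝓝[D ∩ Set.Ioi t] t, x s < a) (hb : ∃ᶠ s in 𝓝[D ∩ Set.Ioi t] t, b < x s) (m : ℕ) :
    ∃ u > t, HasUpcrossings x a b D m u := by
  have key : ∀ {p : I → Prop}, (∃ᶠ s in 𝓝[D ∩ Set.Ioi t] t, p s) → ∀ w > t,
      ∃ s ∈ D, t < s ∧ s < w ∧ p s := fun {p} hp w hw => by
    have h1 : ∀ᶠ s in 𝓝[D ∩ Set.Ioi t] t, s < w :=
      eventually_nhdsWithin_of_eventually_nhds (gt_mem_nhds hw)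
    obtain ⟨s, ⟨h2, h3⟩, h4⟩ := ((hp.and_eventually h1).and_eventually self_mem_nhdsWithin).exists
    exact ⟨s, h4.1, h4.2, h3, h2⟩
  induction m with
  | zero =>
    obtain ⟨s, -, hs⟩ := ((ha.and_eventually self_mem_nhdsWithin).exists)
    exact ⟨s, hs.2, trivial⟩
  | succ m ih =>
    obtain ⟨u, hu, h⟩ := ih
    obtain ⟨q, hqD, htq, hqu, hq⟩ := key hb u hu
    obtain ⟨p, hpD, htp, hpq, hp⟩ := key ha q htq
    obtain ⟨v, htv, hvp⟩ := exists_between htp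
    exact ⟨v, htv, p, hpD, q, hqD, hvp, hpq, hp, hq, h.of_le hqu.le⟩

/-- If `x` oscillates infinitely often across `[a, b]` at times increasing to `t`, then it has
arbitrarily many upcrossings after any `u < t`. -/
lemma hasUpcrossings_of_frequently_left {x : I → ℝ} {a b : ℝ} {D : Set I} {t : I}
    (ha : ∃ᶠ s in 𝓝[D ∩ Set.Iio t] t, x s < a) (hb : ∃ᶠ s in 𝓝[D ∩ Set.Iio t] t, b < x s) (m : ℕ) :
    ∀ u < t, HasUpcrossings x a b D m u := by
  have key : ∀ {p : I → Prop}, (∃ᶠ s in 𝓝[D ∩ Set.Iio t] t, p s) → ∀ w < t,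
      ∃ s ∈ D, w < s ∧ s < t ∧ p s := fun {p} hp w hw => by
    have h1 : ∀ᶠ s in 𝓝[D ∩ Set.Iio t] t, w < s :=
      eventually_nhdsWithin_of_eventually_nhds (lt_mem_nhds hw)
    obtain ⟨s, ⟨h2, h3⟩, h4⟩ := ((hp.and_eventually h1).and_eventually self_mem_nhdsWithin).exists
    exact ⟨s, h4.1, h3, h4.2, h2⟩
  induction m with
  | zero => exact fun u _ => trivial
  | succ m ih =>
    intro u hu
    obtain ⟨p, hpD, hup, hpt, hp⟩ := key ha u hu
    obtain ⟨q, hqD, hpq, hqt, hq⟩ := key hb p hpt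
    exact ⟨p, hpD, q, hqD, hup, hpq, hp, hq, ih q hqt⟩

/-- A path is regular on the dyadic times if it is bounded there and has only finitely many
upcrossings of each rational interval. -/
structure IsDyadicRegular (x : I → ℝ) : Prop where
  bounded : ∃ C : ℝ, ∀ s ∈ dyadicTimes, |x s| ≤ C
  upcrossings : ∀ a b : ℚ, a < b → ∃ m, ¬ HasUpcrossings x a b dyadicTimes m 0

lemma IsDyadicRegular.exists_tendsto {x : I → ℝ} (hx : IsDyadicRegular x) {t : I} {l : Filter I}
    (hl : l = 𝓝[dyadicTimes ∩ Set.Ioi t] t ∨ l = 𝓝[dyadicTimes ∩ Set.Iio t] t) :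
    ∃ y, Tendsto x l (𝓝 y) := by
  obtain ⟨C, hC⟩ := hx.bounded
  have hD : ∀ᶠ s in l, s ∈ dyadicTimes := by
    rcases hl with rfl | rfl <;> filter_upwards [self_mem_nhdsWithin] with s hs using hs.1
  refine tendsto_of_no_upcrossings Rat.denseRange_cast (s := Set.range ((↑) : ℚ → ℝ)) ?_
    ⟨C, eventually_map.2 (hD.mono fun s hs => (abs_le.1 (hC s hs)).2)⟩
    ⟨-C, eventually_map.2 (hD.mono fun s hs => (abs_le.1 (hC s hs)).1)⟩
  rintro _ ⟨a, rfl⟩ _ ⟨b, rfl⟩ hab ⟨ha, hb⟩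
  obtain ⟨m, hm⟩ := hx.upcrossings a b (by exact_mod_cast hab)
  rcases hl with rfl | rfl
  · obtain ⟨u, -, h⟩ := hasUpcrossings_of_frequently_right ha hb m
    exact hm (h.of_le u.2.1)
  · obtain ⟨s, -, hs⟩ := (ha.and_eventually self_mem_nhdsWithin).exists
    exact hm (hasUpcrossings_of_frequently_left ha hb m 0 (lt_of_le_of_lt s.2.1 hs.2))

lemma nhdsWithin_dyadicTimes_Ioi_neBot {t : I} (ht : t < 1) :
    (𝓝[dyadicTimes ∩ Set.Ioi t] t).NeBot := by
  rw [← mem_closure_iff_nhdsWithin_neBot, Set.inter_comm]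
  have h := closure_minimal (dense_dyadicTimes.open_subset_closure_inter (isOpen_Ioi (a := t)))
    isClosed_closure
  rw [closure_Ioi' (a := t) ⟨1, ht⟩] at h
  exact h Set.self_mem_Ici

/-- The right limits of `x` along the dyadic times. -/
noncomputable def dyadicRightLim (x : I → ℝ) (t : I) : ℝ :=
  limUnder (𝓝[dyadicTimes ∩ Set.Ioi t] t) x

lemma IsDyadicRegular.tendsto_dyadicRightLim {x : I → ℝ} (hx : IsDyadicRegular x) (t : I) :
    Tendsto x (𝓝[dyadicTimes ∩ Set.Ioi t] t) (𝓝 (dyadicRightLim x t)) :=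
  tendsto_nhds_limUnder (hx.exists_tendsto (Or.inl rfl))

lemma IsDyadicRegular.dyadicRightLim_mem {x : I → ℝ} (hx : IsDyadicRegular x) {s : I} (hs : s < 1)
    {V : Set ℝ} (hV : IsClosed V) {u : I} (hsu : s < u)
    (h : ∀ r ∈ dyadicTimes, s < r → r < u → x r ∈ V) : dyadicRightLim x s ∈ V := by
  have := nhdsWithin_dyadicTimes_Ioi_neBot hs
  refine hV.mem_of_tendsto (hx.tendsto_dyadicRightLim s) ?_
  filter_upwards [self_mem_nhdsWithin,
    eventually_nhdsWithin_of_eventually_nhds (gt_mem_nhds hsu)] with r hr hru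
  exact h r hr.1 hr.2 hru

lemma IsDyadicRegular.rightContinuous {x : I → ℝ} (hx : IsDyadicRegular x) {t : I} (ht : t < 1) :
    ContinuousWithinAt (dyadicRightLim x) (Set.Ici t) t := by
  rw [← continuousWithinAt_Ioi_iff_Ici, ContinuousWithinAt, (closed_nhds_basis _).tendsto_right_iff]
  rintro V ⟨hV, hVc⟩
  have h1 := hx.tendsto_dyadicRightLim t hV
  rw [mem_map, mem_nhdsWithin] at h1
  obtain ⟨O, hO, htO, hOV⟩ := h1
  obtain ⟨u, htu, hu⟩ := exists_Ico_subset_of_mem_nhds (hO.mem_nhds htO) ⟨1, ht⟩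
  filter_upwards [Ioo_mem_nhdsGT htu] with s hs
  exact hx.dyadicRightLim_mem (hs.2.trans_le u.2.2) hVc hs.2 fun r hr hsr hru =>
    hOV ⟨hu ⟨(hs.1.trans hsr).le, hru⟩, hr, hs.1.trans hsr⟩

lemma IsDyadicRegular.leftLimit {x : I → ℝ} (hx : IsDyadicRegular x) (t : I) :
    ∃ y, Tendsto (dyadicRightLim x) (𝓝[<] t) (𝓝 y) := by
  obtain ⟨y, hy⟩ := hx.exists_tendsto (t := t) (Or.inr rfl)
  refine ⟨y, ?_⟩
  rcases (show 0 ≤ t from t.2.1).eq_or_lt with rfl | h0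
  · rw [show Set.Iio (0 : I) = ∅ from Set.eq_empty_of_forall_notMem fun s hs =>
      absurd (show (s : ℝ) < 0 from hs) s.2.1.not_gt, nhdsWithin_empty]
    exact tendsto_bot
  rw [(closed_nhds_basis _).tendsto_right_iff]
  rintro V ⟨hV, hVc⟩
  have h1 := hy hV
  rw [mem_map, mem_nhdsWithin] at h1
  obtain ⟨O, hO, htO, hOV⟩ := h1
  obtain ⟨u, hut, hu⟩ := exists_Ioc_subset_of_mem_nhds (hO.mem_nhds htO) ⟨0, h0⟩
  filter_upwards [Ioo_mem_nhdsLT hut] with s hs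
  exact hx.dyadicRightLim_mem (hs.2.trans_le t.2.2) hVc hs.2 fun r hr hsr hrt =>
    hOV ⟨hu ⟨hs.1.trans hsr, hrt.le⟩, hr, hrt⟩

/-! ### Càdlàg modifications of martingales -/

/-- The dyadic time `k / 2 ^ n`, stopped at `1`. -/
noncomputable def dyadicPoint (n k : ℕ) : I :=
  ⟨min (k / 2 ^ n) 1, le_min (by positivity) zero_le_one, min_le_right _ _⟩

lemma dyadicPoint_mono (n : ℕ) : Monotone (dyadicPoint n) := fun i j hij =>
  Subtype.coe_le_coe.1 (min_le_min_right _ (by gcongr))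

lemma dyadicPoint_eq_one {n k : ℕ} (h : 2 ^ n ≤ k) : dyadicPoint n k = 1 := by
  refine Subtype.ext (min_eq_right ?_)
  rw [le_div_iff₀ (by positivity), one_mul]
  exact_mod_cast h

lemma exists_dyadicPoint_eq {n : ℕ} {t : I} (ht : t ∈ dyadicLevel n) :
    ∃ k ≤ 2 ^ n, dyadicPoint n k = t := by
  obtain ⟨k, hk⟩ := ht
  have h1 : (k : ℝ) / 2 ^ n ≤ 1 := hk ▸ t.2.2
  refine ⟨k, ?_, Subtype.ext ?_⟩
  · rw [div_le_one (by positivity)] at h1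
    exact_mod_cast h1
  · rw [hk]
    exact min_eq_left h1

lemma dyadicPoint_zero (n : ℕ) : dyadicPoint n 0 = 0 := Subtype.ext (by simp [dyadicPoint])

/-- Successive upcrossings of a path at dyadic times of level `n` are counted by Mathlib's
`upcrossingsBefore` of the sampled sequence. -/
lemma HasUpcrossings.add_le_upcrossingsBefore {Ω : Type*} {X : I → Ω → ℝ} {ω : Ω} {a b : ℝ}
    (hab : a < b) {n m k : ℕ} (hk : k ≤ 2 ^ n)
    (h : HasUpcrossings (fun t => X t ω) a b (dyadicLevel n) m (dyadicPoint n k)) :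
    upcrossingsBefore a b (fun k => X (dyadicPoint n k)) (k + 1) ω + m ≤
      upcrossingsBefore a b (fun k => X (dyadicPoint n k)) (2 ^ n + 1) ω := by
  induction m generalizing k with
  | zero => exact upcrossingsBefore_mono hab (by gcongr) ω
  | succ m ih =>
    obtain ⟨p, hp, q, hq, hup, hpq, ha, hb, h⟩ := h
    obtain ⟨i, hi, rfl⟩ := exists_dyadicPoint_eq hp
    obtain ⟨j, hj, rfl⟩ := exists_dyadicPoint_eq hq
    have hki : k < i := (dyadicPoint_mono n).reflect_lt hup
    have hij : i < j := (dyadicPoint_mono n).reflect_lt hpq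
    have := upcrossingsBefore_lt_of_exists_upcrossing
      (f := fun k => X (dyadicPoint n k)) (ω := ω) hab (N := k + 1) hki ha hij.le hb
    have := ih hj h
    omega

section Martingale

variable {Ω : Type*} {m : MeasurableSpace Ω} {P : Measure Ω} {𝓕 : Filtration I m}

/-- The filtration `𝓕` sampled at the dyadic times of level `n`. -/
noncomputable def dyadicFiltration (𝓕 : Filtration I m) (n : ℕ) : Filtration ℕ m where
  seq k := 𝓕 (dyadicPoint n k)
  mono' _ _ h := 𝓕.mono (dyadicPoint_mono n h)
  le' _ := 𝓕.le _

lemma MeasureTheory.Martingale.dyadic {E : Type*} [NormedAddCommGroup E] [NormedSpace ℝ E]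
    {X : I → Ω → E} (hX : Martingale X 𝓕 P) (n : ℕ) :
    Martingale (fun k => X (dyadicPoint n k)) (dyadicFiltration 𝓕 n) P :=
  ⟨fun _ => hX.1 _, fun _ _ h => hX.2 _ _ (dyadicPoint_mono n h)⟩

variable [IsFiniteMeasure P]

/-- Doob's upcrossing inequality and Markov's inequality, with a bound that does not depend on the
level `n`. -/
lemma MeasureTheory.Martingale.measure_hasUpcrossings_level {X : I → Ω → ℝ}
    (hX : Martingale X 𝓕 P) {a b : ℝ} (hab : a < b) (n k : ℕ) :
    k * P.real {ω | HasUpcrossings (fun t => X t ω) a b (dyadicLevel n) k 0} ≤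
      (∫ ω, (X 1 ω - a)⁺ ∂P) / (b - a) := by
  set f := fun k => X (dyadicPoint n k)
  have hf := (hX.dyadic n).submartingale
  have h1 := hf.mul_integral_upcrossingsBefore_le_integral_pos_part a b (2 ^ n + 1)
  rw [dyadicPoint_eq_one (by omega)] at h1
  have h2 := mul_meas_ge_le_integral_of_nonneg (μ := P)
    (f := fun ω => (upcrossingsBefore a b f (2 ^ n + 1) ω : ℝ)) (.of_forall fun ω => by positivity)
    (hf.1.integrable_upcrossingsBefore hab) k
  rw [le_div_iff₀' (sub_pos.2 hab)]
  refine le_trans ?_ h1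
  refine mul_le_mul_of_nonneg_left (le_trans ?_ h2) (sub_pos.2 hab).le
  refine mul_le_mul_of_nonneg_left (measureReal_mono fun ω hω => ?_) (Nat.cast_nonneg k)
  have := HasUpcrossings.add_le_upcrossingsBefore (X := X) (ω := ω) (n := n) (m := k) (k := 0) hab
    (Nat.zero_le _) (by rw [dyadicPoint_zero]; exact hω)
  rw [Set.mem_ofPred_eq, Nat.cast_le]
  exact (Nat.le_add_left _ _).trans this

lemma MeasureTheory.Martingale.ae_upcrossings {X : I → Ω → ℝ}
    (hX : Martingale X 𝓕 P) {a b : ℝ} (hab : a < b) :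
    ∀ᵐ ω ∂P, ∃ k, ¬ HasUpcrossings (fun t => X t ω) a b dyadicTimes k 0 := by
  set C := (∫ ω, (X 1 ω - a)⁺ ∂P) / (b - a)
  have h1 : ∀ k : ℕ, 0 < k →
      P {ω | HasUpcrossings (fun t => X t ω) a b dyadicTimes k 0} ≤ ENNReal.ofReal (C / k) := by
    intro k hk
    have hU : {ω | HasUpcrossings (fun t => X t ω) a b dyadicTimes k 0} ⊆
        ⋃ n, {ω | HasUpcrossings (fun t => X t ω) a b (dyadicLevel n) k 0} :=
      fun ω hω => Set.mem_iUnion.2 (HasUpcrossings.exists_level hω)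
    refine (measure_mono hU).trans ?_
    have hmono : Monotone fun n =>
        {ω | HasUpcrossings (fun t => X t ω) a b (dyadicLevel n) k 0} :=
      fun i j hij ω hω => HasUpcrossings.mono (dyadicLevel_mono hij) hω
    rw [hmono.measure_iUnion]
    refine iSup_le fun n => ?_
    have := hX.measure_hasUpcrossings_level hab n k
    rw [← ofReal_measureReal]
    refine ENNReal.ofReal_le_ofReal ?_
    rwa [le_div_iff₀' (by positivity)]
  have h2 : Tendsto (fun k : ℕ => ENNReal.ofReal (C / k)) atTop (𝓝 0) := by
    simpa using ENNReal.tendsto_ofReal (tendsto_const_div_atTop_nhds_zero_nat C)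
  rw [ae_iff]
  refine le_antisymm (ge_of_tendsto h2 ?_) zero_le
  filter_upwards [eventually_gt_atTop 0] with k hk
  refine (measure_mono fun ω hω => ?_).trans (h1 k hk)
  simp only [not_exists, not_not, Set.mem_ofPred_eq] at hω
  exact hω k

/-- Doob's maximal inequality for `|X|` on the dyadic times. -/
lemma MeasureTheory.Martingale.measure_exists_abs_gt {X : I → Ω → ℝ}
    (hX : Martingale X 𝓕 P) {c : NNReal} :
    c * P {ω | ∃ s ∈ dyadicTimes, c < |X s ω|} ≤ ENNReal.ofReal (∫ ω, |X 1 ω| ∂P) := by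
  have hU : {ω | ∃ s ∈ dyadicTimes, c < |X s ω|} ⊆
      ⋃ n, {ω | ∃ s ∈ dyadicLevel n, c < |X s ω|} := by
    rintro ω ⟨s, hs, h⟩
    obtain ⟨n, hn⟩ := Set.mem_iUnion.1 hs
    exact Set.mem_iUnion.2 ⟨n, s, hn, h⟩
  refine (mul_le_mul_right (measure_mono hU) _).trans ?_
  have hmono : Monotone fun n => {ω | ∃ s ∈ dyadicLevel n, c < |X s ω|} :=
    fun i j hij ω ⟨s, hs, h⟩ => ⟨s, dyadicLevel_mono hij hs, h⟩
  rw [hmono.measure_iUnion, ENNReal.mul_iSup]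
  refine iSup_le fun n => ?_
  have hsub := (hX.dyadic n).submartingale.sup (hX.dyadic n).neg.submartingale
  set g := (fun k => X (dyadicPoint n k)) ⊔ -(fun k => X (dyadicPoint n k)) with hg
  have hgk : ∀ k ω, g k ω = |X (dyadicPoint n k) ω| := fun k ω => rfl
  have h1 := maximal_ineq hsub (fun k ω => by rw [hgk]; exact abs_nonneg _) (ε := c) (2 ^ n)
  refine (mul_le_mul_right (measure_mono ?_) _).trans (h1.trans (ENNReal.ofReal_le_ofReal ?_))
  · rintro ω ⟨s, hs, h⟩
    obtain ⟨k, hk, rfl⟩ := exists_dyadicPoint_eq hs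
    refine le_trans h.le ?_
    rw [← hgk]
    exact Finset.le_sup' (fun k => g k ω) (Finset.mem_range.2 (by omega))
  · simp_rw [hgk, dyadicPoint_eq_one le_rfl]
    exact setIntegral_le_integral (hX.integrable 1).abs (.of_forall fun ω => abs_nonneg _)

lemma MeasureTheory.Martingale.ae_isDyadicRegular {X : I → Ω → ℝ} (hX : Martingale X 𝓕 P) :
    ∀ᵐ ω ∂P, IsDyadicRegular fun t => X t ω := by
  have h1 : ∀ᵐ ω ∂P, ∃ C : ℝ, ∀ s ∈ dyadicTimes, |X s ω| ≤ C := by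
    have h2 : Tendsto (fun k : ℕ => ENNReal.ofReal ((∫ ω, |X 1 ω| ∂P) / k)) atTop (𝓝 0) := by
      simpa using ENNReal.tendsto_ofReal (tendsto_const_div_atTop_nhds_zero_nat _)
    rw [ae_iff]
    refine le_antisymm (ge_of_tendsto h2 ?_) zero_le
    filter_upwards [eventually_gt_atTop 0] with k hk
    have h3 := hX.measure_exists_abs_gt (c := k)
    rw [ENNReal.ofReal_div_of_pos (by positivity), ENNReal.le_div_iff_mul_le (by simp [hk.ne'])
      (by simp), mul_comm]
    refine le_trans ?_ h3
    simp only [ENNReal.ofReal_natCast, ENNReal.coe_natCast]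
    refine mul_le_mul_right (measure_mono fun ω hω => ?_) _
    simp only [not_exists, not_forall, not_le, Set.mem_ofPred_eq, exists_prop] at hω
    simpa using hω k
  have h2 : ∀ᵐ ω ∂P, ∀ a b : ℚ, a < b →
      ∃ k, ¬ HasUpcrossings (fun t => X t ω) a b dyadicTimes k 0 := by
    simp_rw [ae_all_iff]
    exact fun a b hab => hX.ae_upcrossings (by exact_mod_cast hab)
  filter_upwards [h1, h2] with ω hω hω' using ⟨hω, hω'⟩

open scoped Classical in
/-- Every martingale on `[0,1]` for a complete right-continuous filtration has a modification on
`[0,1)` all of whose paths are càdlàg: the right limits along the dyadic times. -/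
lemma MeasureTheory.Martingale.exists_cadlag_modification {X : I → Ω → ℝ} (hX : Martingale X 𝓕 P)
    [𝓕.IsRightContinuous] (hcomp : ∀ A, P A = 0 → MeasurableSet[𝓕 0] A) :
    ∃ Y : I → Ω → ℝ, (∀ t < 1, StronglyMeasurable[𝓕 t] (Y t)) ∧ (∀ t < 1, Y t =ᵐ[P] X t) ∧
      (∀ ω, ∀ t < (1 : I), ContinuousWithinAt (fun s => Y s ω) (Set.Ici t) t) ∧
      ∀ ω, ∀ t : I, ∃ l, Tendsto (fun s => Y s ω) (𝓝[<] t) (𝓝 l) := by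
  set G : Set Ω := {ω | IsDyadicRegular fun t => X t ω}
  have hGae : ∀ᵐ ω ∂P, ω ∈ G := hX.ae_isDyadicRegular
  have hG0 : MeasurableSet[𝓕 0] G := by
    have := (hcomp Gᶜ hGae).compl
    rwa [compl_compl] at this
  have hG : ∀ t, MeasurableSet[𝓕 t] G := fun t => 𝓕.mono t.2.1 _ hG0
  set Y : I → Ω → ℝ := fun t ω => if ω ∈ G then dyadicRightLim (fun s => X s ω) t else 0 with hY
  have hseq : ∀ t < (1 : I), ∃ q : ℕ → I, (∀ k, t < q k) ∧ Tendsto q atTop (𝓝 t) ∧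
      ∀ ω, Tendsto (fun k => G.indicator (X (q k)) ω) atTop (𝓝 (Y t ω)) := by
    intro t ht
    have := nhdsWithin_dyadicTimes_Ioi_neBot ht
    obtain ⟨q, hq⟩ := exists_seq_tendsto (𝓝[dyadicTimes ∩ Set.Ioi t] t)
    -- Discard the finitely many terms of the sequence outside `dyadicTimes ∩ Set.Ioi t`.
    obtain ⟨K, hK⟩ := eventually_atTop.1 (hq.eventually self_mem_nhdsWithin)
    refine ⟨fun k => q (k + K), fun k => (hK _ (by omega)).2,
      (tendsto_nhds_of_tendsto_nhdsWithin hq).comp (tendsto_add_atTop_nat K), fun ω => ?_⟩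
    by_cases hω : ω ∈ G
    · simp only [hY, hω, if_true, Set.indicator_of_mem]
      exact (IsDyadicRegular.tendsto_dyadicRightLim hω t).comp
        (hq.comp (tendsto_add_atTop_nat K))
    · simp [hY, hω]
  have hYmeas : ∀ t < 1, StronglyMeasurable[𝓕 t] (Y t) := by
    intro t ht
    obtain ⟨q, htq, hqt, hq⟩ := hseq t ht
    have h1 : ∀ u > t, Measurable[𝓕 u] (Y t) := by
      intro u hu
      obtain ⟨K, hK⟩ := eventually_atTop.1 (hqt.eventually (gt_mem_nhds hu))
      refine (stronglyMeasurable_of_tendsto (m := 𝓕 u) (u := atTop)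
        (f := fun k => G.indicator (X (q (k + K)))) (g := Y t) (fun k => ?_) ?_).measurable
      · exact ((hX.1 _).mono (𝓕.mono (hK _ (by omega)).le)).indicator (hG u)
      · exact tendsto_pi_nhds.2 fun ω => (hq ω).comp (tendsto_add_atTop_nat K)
    refine Measurable.stronglyMeasurable fun s hs => ?_
    apply Filtration.IsRightContinuous.measurableSet
    have : ¬ IsMax t := not_isMax_iff.2 ⟨1, ht⟩
    rw [Filtration.rightCont_eq_of_not_isMax _ this]
    simp only [MeasurableSpace.measurableSet_iInf]
    exact fun u hu => h1 u hu hs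
  refine ⟨Y, hYmeas, fun t ht => ?_, fun ω t ht => ?_, fun ω t => ?_⟩
  · obtain ⟨q, htq, hqt, hq⟩ := hseq t ht
    have hqX : ∀ᵐ ω ∂P, Tendsto (fun k => X (q k) ω) atTop (𝓝 (Y t ω)) := by
      filter_upwards [hGae] with ω hω
      simpa [Set.indicator_of_mem hω] using hq ω
    have hUI : UniformIntegrable (fun k => X (q k)) 1 P :=
      ((hX.integrable 1).uniformIntegrable_condExp fun k => 𝓕.le (q k)).ae_eq
        fun k => hX.2 _ _ (q k).2.2
    have hYL : MemLp (Y t) 1 P := by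
      obtain ⟨C, hC⟩ := hUI.2.2
      refine ⟨((hYmeas t ht).mono (𝓕.le t)).aestronglyMeasurable, lt_of_le_of_lt
        (Lp.eLpNorm_lim_le_liminf_eLpNorm (fun k => (hX.integrable (q k)).1) _ hqX) ?_⟩
      refine lt_of_le_of_lt (liminf_le_of_le (a := (C : ENNReal)) (by isBoundedDefault) ?_)
        ENNReal.coe_lt_top
      intro b hb
      obtain ⟨k, hk⟩ := hb.exists
      exact hk.trans (hC k)
    have hlim := tendsto_Lp_finite_of_tendsto_ae le_rfl ENNReal.one_ne_top
      (fun k => (hX.integrable (q k)).1) hYL hUI.2.1 hqX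
    have hYint := memLp_one_iff_integrable.1 hYL
    have hle : ∀ k, eLpNorm (X t - Y t) 1 P ≤ eLpNorm (X (q k) - Y t) 1 P := by
      intro k
      have h1 : X t - Y t =ᵐ[P] P[X (q k) - Y t | 𝓕 t] := by
        filter_upwards [condExp_sub (hX.integrable (q k)) hYint (𝓕 t), hX.2 t (q k) (htq k).le]
          with ω h2 h3
        rw [h2, Pi.sub_apply, Pi.sub_apply, h3,
          condExp_of_stronglyMeasurable (𝓕.le t) (hYmeas t ht) hYint]
      rw [eLpNorm_congr_ae h1]
      exact eLpNorm_condExp_le_eLpNorm _ le_rfl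
    have h0 : eLpNorm (X t - Y t) 1 P = 0 :=
      le_antisymm (ge_of_tendsto' hlim hle) zero_le
    rw [eLpNorm_eq_zero_iff ((hX.integrable t).1.sub hYint.1) one_ne_zero] at h0
    filter_upwards [h0] with ω hω
    exact (sub_eq_zero.1 hω).symm
  · by_cases hω : ω ∈ G
    · simp only [hY, hω, if_true]
      exact IsDyadicRegular.rightContinuous hω ht
    · simp only [hY, hω, if_false]
      exact continuousWithinAt_const
  · by_cases hω : ω ∈ G
    · simp only [hY, hω, if_true]
      exact IsDyadicRegular.leftLimit hω t
    · exact ⟨0, by simp only [hY, hω, if_false]; exact tendsto_const_nhds⟩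

/-- Componentwise, the same holds for martingales with values in `ℝ^d`. -/
lemma MeasureTheory.Martingale.exists_cadlag_modification_euclidean {d : ℕ}
    {X : I → Ω → EuclideanSpace ℝ (Fin d)} (hX : Martingale X 𝓕 P)
    [𝓕.IsRightContinuous] (hcomp : ∀ A, P A = 0 → MeasurableSet[𝓕 0] A) :
    ∃ Y : I → Ω → EuclideanSpace ℝ (Fin d),
      (∀ t < 1, StronglyMeasurable[𝓕 t] (Y t)) ∧ (∀ t < 1, Y t =ᵐ[P] X t) ∧
      (∀ ω, ∀ t < (1 : I), ContinuousWithinAt (fun s => Y s ω) (Set.Ici t) t) ∧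
      ∀ ω, ∀ t : I, ∃ l, Tendsto (fun s => Y s ω) (𝓝[<] t) (𝓝 l) := by
  have hi : ∀ i : Fin d, Martingale (fun t ω => X t ω i) 𝓕 P := fun i => by
    let p : EuclideanSpace ℝ (Fin d) →L[ℝ] ℝ := EuclideanSpace.proj i
    refine ⟨fun t => p.continuous.comp_stronglyMeasurable (hX.1 t), fun s t hst => ?_⟩
    have h1 := p.comp_condExp_comm (m := 𝓕 s) (hX.integrable t)
    filter_upwards [h1, hX.2 s t hst] with ω h2 h3
    have : P[fun ω => X t ω i | 𝓕 s] ω = p (P[X t | 𝓕 s] ω) := h2.symm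
    rw [this, h3]
    rfl
  choose Y hY1 hY2 hY3 hY4 using fun i => (hi i).exists_cadlag_modification hcomp
  refine ⟨fun t ω => WithLp.toLp 2 fun i => Y i t ω, fun t ht => ?_, fun t ht => ?_,
    fun ω t ht => ?_, fun ω t => ?_⟩
  · have h1 : Measurable[𝓕 t] fun ω i => Y i t ω :=
      @measurable_pi_lambda _ _ _ (𝓕 t) _ _ fun i => (hY1 i t ht).measurable
    exact (PiLp.continuous_toLp 2 _).comp_stronglyMeasurable h1.stronglyMeasurable
  · filter_upwards [ae_all_iff.2 fun i => hY2 i t ht] with ω hω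
    ext i
    exact hω i
  · exact (PiLp.continuous_toLp 2 _).continuousAt.comp_continuousWithinAt
      (continuousWithinAt_pi.2 fun i => hY3 i ω t ht)
  · choose l hl using fun i => hY4 i ω t
    exact ⟨WithLp.toLp 2 l, ((PiLp.continuous_toLp 2 _).tendsto _).comp (tendsto_pi_nhds.2 hl)⟩

end Martingale

/-! ### Increments of Cameron-Martin paths -/

section CameronMartinPaths

variable {d : ℕ}

lemma cmPath_zero (h : CameronMartin d) : cmPath h 0 = 0 := by
  have h0 : Set.Iic (0 : I) = {0} := by
    ext t
    exact ⟨fun ht => le_antisymm ht t.2.1, fun ht => le_of_eq ht⟩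
  change ∫ s in Set.Iic (0 : I), h s = 0
  rw [h0]
  simp

lemma cmPath_sub_cmPath (h : CameronMartin d) {a b : I} (hab : a ≤ b) :
    cmPath h b - cmPath h a = ∫ s in Set.Ioc a b, h s := by
  change (∫ s in Set.Iic b, h s) - ∫ s in Set.Iic a, h s = _
  rw [← Set.Iic_union_Ioc_eq_Iic hab, setIntegral_union (Set.Iic_disjoint_Ioc le_rfl)
    measurableSet_Ioc (cm_integrable h).integrableOn (cm_integrable h).integrableOn,
    add_sub_cancel_left]

lemma cm_integrable_norm_sq (h : CameronMartin d) : Integrable (fun s => ‖h s‖ ^ 2) :=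
  (memLp_two_iff_integrable_sq_norm (Lp.memLp h).1).1 (Lp.memLp h)

lemma cm_norm_sq (h : CameronMartin d) : ‖h‖ ^ 2 = ∫ s, ‖h s‖ ^ 2 := by
  rw [← real_inner_self_eq_norm_sq, L2.inner_def]
  simp

lemma volume_real_Ioc {a b : I} (hab : a ≤ b) :
    (volume : Measure I).real (Set.Ioc a b) = b - a := by
  rw [measureReal_def, unitInterval.volume_Ioc, ENNReal.toReal_ofReal (sub_nonneg.2 hab)]

lemma norm_cmPath_sub_sq_le (h : CameronMartin d) {a b : I} (hab : a ≤ b) :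
    ‖cmPath h b - cmPath h a‖ ^ 2 ≤ (b - a) * ∫ s in Set.Ioc a b, ‖h s‖ ^ 2 := by
  rw [cmPath_sub_cmPath h hab]
  have h1 : ‖∫ s in Set.Ioc a b, h s‖ ≤ ∫ s in Set.Ioc a b, ‖h s‖ := norm_integral_le_integral_norm _
  have h2 := integral_mul_le_Lp_mul_Lq_of_nonneg (μ := volume.restrict (Set.Ioc a b))
    Real.HolderConjugate.two_two (f := fun _ => (1 : ℝ)) (g := fun s => ‖h s‖)
    (.of_forall fun _ => zero_le_one) (.of_forall fun _ => norm_nonneg _)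
    (memLp_const _) (by simpa using ((Lp.memLp h).norm.restrict _))
  simp only [one_mul, integral_const, smul_eq_mul, one_pow, mul_one, Real.rpow_two,
    measureReal_restrict_apply MeasurableSet.univ, Set.univ_inter, volume_real_Ioc hab] at h2
  have h3 := pow_le_pow_left₀ (norm_nonneg _) (h1.trans h2) 2
  rw [mul_pow, ← Real.sqrt_eq_rpow, ← Real.sqrt_eq_rpow, Real.sq_sqrt (sub_nonneg.2 hab),
    Real.sq_sqrt (integral_nonneg fun _ => by positivity)] at h3
  exact h3

lemma norm_cmPath_sub_le (h : CameronMartin d) {a b : I} (hab : a ≤ b) :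
    ‖cmPath h b - cmPath h a‖ ≤ ‖h‖ := by
  refine (sq_le_sq₀ (norm_nonneg _) (norm_nonneg _)).1 ?_
  have h1 : ∫ s in Set.Ioc a b, ‖h s‖ ^ 2 ≤ ‖h‖ ^ 2 := by
    rw [cm_norm_sq]
    exact setIntegral_le_integral (cm_integrable_norm_sq h) (.of_forall fun _ => by positivity)
  have h2 : (0 : ℝ) ≤ ∫ s in Set.Ioc a b, ‖h s‖ ^ 2 := integral_nonneg fun _ => by positivity
  have h3 : (b : ℝ) - a ≤ 1 := by linarith [b.2.2, a.2.1]
  calc _ ≤ (b - a) * ∫ s in Set.Ioc a b, ‖h s‖ ^ 2 := norm_cmPath_sub_sq_le h hab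
    _ ≤ 1 * ‖h‖ ^ 2 := mul_le_mul h3 h1 h2 zero_le_one
    _ = ‖h‖ ^ 2 := one_mul _

lemma norm_cmPath_apply_le (h : CameronMartin d) (t : I) : ‖cmPath h t‖ ≤ ‖h‖ := by
  simpa [cmPath_zero] using norm_cmPath_sub_le h (show 0 ≤ t from t.2.1)

/-- Evaluation at time `t` of the path of an element of the Cameron-Martin space. -/
noncomputable def cmEval (t : I) : CameronMartin d →L[ℝ] Euc d :=
  LinearMap.mkContinuous
    { toFun := fun h => cmPath h t
      map_add' := fun h k => by
        change ∫ s in Set.Iic t, (h + k) s = (∫ s in Set.Iic t, h s) + ∫ s in Set.Iic t, k s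
        rw [← integral_add (cm_integrable h).integrableOn (cm_integrable k).integrableOn]
        exact integral_congr_ae (ae_restrict_of_ae (Lp.coeFn_add h k))
      map_smul' := fun c h => by
        change ∫ s in Set.Iic t, (c • h) s = c • ∫ s in Set.Iic t, h s
        rw [← integral_smul]
        exact integral_congr_ae (ae_restrict_of_ae (Lp.coeFn_smul c h)) }
    1 fun h => by simpa using norm_cmPath_apply_le h t

@[simp] lemma cmEval_apply (t : I) (h : CameronMartin d) : cmEval t h = cmPath h t := rfl

lemma ae_eq_zero_of_forall_integral_Iic_eq_zero {f : I → Euc d} (hf : Integrable f)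
    (h : ∀ t, ∫ s in Set.Iic t, f s = 0) : f =ᵐ[volume] 0 := by
  have h1 : ∀ s, MeasurableSet s → ∫ x in s, f x = 0 := by
    have huniv : ∫ x, f x = 0 := by
      rw [← setIntegral_univ, ← h 1]
      congr 2
      exact (Set.eq_univ_of_forall fun t => t.2.2).symm
    intro s hs
    induction s, hs using MeasurableSpace.induction_on_inter
      (BorelSpace.measurable_eq.trans (borel_eq_generateFrom_Iic I)) isPiSystem_Iic with
    | empty => simp
    | basic s hs => obtain ⟨t, rfl⟩ := hs; exact h t
    | compl s hs ih => rw [setIntegral_compl hs hf, huniv, ih, sub_zero]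
    | iUnion s hd hs ih => rw [integral_iUnion hs hd hf.integrableOn]; simp [ih]
  exact hf.ae_eq_zero_of_forall_setIntegral_eq_zero fun s hs _ => h1 s hs

/-! ### Uniform grids -/

/-- The `i`-th point `T i / n` of the uniform grid of `[0,T]` with `n` cells, stopped at `T`. -/
noncomputable def gridPoint (T : I) (n i : ℕ) : I :=
  T * ⟨min (i / n) 1, le_min (by positivity) zero_le_one, min_le_right _ _⟩

lemma gridPoint_coe {n i : ℕ} (hi : i ≤ n) (T : I) : (gridPoint T n i : ℝ) = T * (i / n) := by
  have : (i : ℝ) / n ≤ 1 := div_le_one_of_le₀ (by exact_mod_cast hi) (by positivity)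
  simp [gridPoint, this]

lemma gridPoint_mono (T : I) (n : ℕ) : Monotone (gridPoint T n) := fun i j hij => by
  refine Subtype.coe_le_coe.1 ?_
  simp only [gridPoint, Set.Icc.coe_mul]
  exact mul_le_mul_of_nonneg_left (min_le_min_right _ (by gcongr)) T.2.1

lemma gridPoint_zero (T : I) (n : ℕ) : gridPoint T n 0 = 0 := by
  ext; simp [gridPoint]

lemma gridPoint_self (T : I) {n : ℕ} (hn : 0 < n) : gridPoint T n n = T := by
  ext; simp [gridPoint_coe le_rfl, hn.ne']

lemma gridPoint_le (T : I) (n i : ℕ) : gridPoint T n i ≤ T :=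
  Subtype.coe_le_coe.1 (by simpa [gridPoint] using mul_le_of_le_one_right T.2.1 (min_le_right _ _))

lemma gridPoint_succ_sub (T : I) {n i : ℕ} (hi : i < n) :
    (gridPoint T n (i + 1) : ℝ) - gridPoint T n i = T / n := by
  rw [gridPoint_coe hi, gridPoint_coe hi.le]
  push_cast
  ring

lemma sum_setIntegral_gridPoint {E : Type*} [NormedAddCommGroup E] [NormedSpace ℝ E] (T : I)
    {n : ℕ} {f : I → E} (hf : IntegrableOn f (Set.Ioc 0 T)) (k : ℕ) :
    ∑ i ∈ Finset.range k, ∫ s in Set.Ioc (gridPoint T n i) (gridPoint T n (i + 1)), f s =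
      ∫ s in Set.Ioc 0 (gridPoint T n k), f s := by
  induction k with
  | zero => simp [gridPoint_zero]
  | succ k ih =>
    have h0 : (0 : I) ≤ gridPoint T n k := (gridPoint T n k).2.1
    have h1 := gridPoint_mono T n (Nat.le_succ k)
    have h2 := gridPoint_le T n (k + 1)
    rw [Finset.sum_range_succ, ih, ← setIntegral_union (Set.Ioc_disjoint_Ioc_of_le le_rfl)
      measurableSet_Ioc (hf.mono_set (Set.Ioc_subset_Ioc_right (h1.trans h2)))
      (hf.mono_set (Set.Ioc_subset_Ioc h0 h2)), Set.Ioc_union_Ioc_eq_Ioc h0 h1]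

/-- The increment of the path of `h` over the `i`-th cell of the grid. -/
noncomputable def gridIncrement (T : I) (n i : ℕ) (h : CameronMartin d) : Euc d :=
  cmPath h (gridPoint T n (i + 1)) - cmPath h (gridPoint T n i)

lemma mul_sum_gridIncrement_sq_le (T : I) {n : ℕ} (h : CameronMartin d) :
    n * ∑ i ∈ Finset.range n, ‖gridIncrement T n i h‖ ^ 2 ≤ ‖h‖ ^ 2 := by
  rcases n.eq_zero_or_pos with rfl | hn
  · simp
  have h1 : ∑ i ∈ Finset.range n, ‖gridIncrement T n i h‖ ^ 2 ≤ ∑ i ∈ Finset.range n,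
      (T : ℝ) / n * ∫ s in Set.Ioc (gridPoint T n i) (gridPoint T n (i + 1)), ‖h s‖ ^ 2 := by
    refine Finset.sum_le_sum fun i hi => ?_
    rw [← gridPoint_succ_sub T (Finset.mem_range.1 hi)]
    exact norm_cmPath_sub_sq_le h (gridPoint_mono T n (Nat.le_succ i))
  rw [← Finset.mul_sum, sum_setIntegral_gridPoint T (cm_integrable_norm_sq h).integrableOn,
    gridPoint_self T hn] at h1
  have h2 : ∫ s in Set.Ioc 0 T, ‖h s‖ ^ 2 ≤ ‖h‖ ^ 2 := by
    rw [cm_norm_sq]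
    exact setIntegral_le_integral (cm_integrable_norm_sq h) (.of_forall fun _ => by positivity)
  have h3 : (0 : ℝ) ≤ ∫ s in Set.Ioc 0 T, ‖h s‖ ^ 2 := integral_nonneg fun _ => by positivity
  have hn' : (0 : ℝ) < n := by exact_mod_cast hn
  calc n * ∑ i ∈ Finset.range n, ‖gridIncrement T n i h‖ ^ 2
      ≤ n * (T / n * ∫ s in Set.Ioc 0 T, ‖h s‖ ^ 2) := by gcongr
    _ = T * ∫ s in Set.Ioc 0 T, ‖h s‖ ^ 2 := by field_simp
    _ ≤ 1 * ‖h‖ ^ 2 := mul_le_mul T.2.2 h2 h3 zero_le_one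
    _ = ‖h‖ ^ 2 := one_mul _

/-! ### Approximation of the Cameron-Martin inner product by increments -/

/-- A Riemann sum for the inner product of `H` in which the increment of `g` is taken over the cell
that follows the cell of the increment of `f`; the last cell is paired with itself. -/
noncomputable def gridPairing (n : ℕ) (f g : CameronMartin d) : ℝ :=
  ∑ i ∈ Finset.range n,
    n * inner ℝ (gridIncrement 1 n i f) (gridIncrement 1 n (min (i + 1) (n - 1)) g)

lemma gridIncrement_sub (T : I) (n i : ℕ) (f g : CameronMartin d) :
    gridIncrement T n i (f - g) = gridIncrement T n i f - gridIncrement T n i g := by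
  simp only [gridIncrement, ← cmEval_apply, map_sub]
  abel

lemma gridPairing_sub_left (n : ℕ) (f f' g : CameronMartin d) :
    gridPairing n (f - f') g = gridPairing n f g - gridPairing n f' g := by
  simp only [gridPairing, gridIncrement_sub, inner_sub_left, mul_sub, Finset.sum_sub_distrib]

lemma gridPairing_sub_right (n : ℕ) (f g g' : CameronMartin d) :
    gridPairing n f (g - g') = gridPairing n f g - gridPairing n f g' := by
  simp only [gridPairing, gridIncrement_sub, inner_sub_right, mul_sub, Finset.sum_sub_distrib]

lemma mul_sum_gridIncrement_shift_sq_le {n : ℕ} (g : CameronMartin d) :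
    n * ∑ i ∈ Finset.range n, ‖gridIncrement 1 n (min (i + 1) (n - 1)) g‖ ^ 2 ≤ 2 * ‖g‖ ^ 2 := by
  rcases n with _ | n
  · simp
  have h0 := mul_sum_gridIncrement_sq_le 1 (n := n + 1) g
  have h1 : ∑ i ∈ Finset.range (n + 1), ‖gridIncrement 1 (n + 1) (min (i + 1) (n + 1 - 1)) g‖ ^ 2 ≤
      2 * ∑ i ∈ Finset.range (n + 1), ‖gridIncrement 1 (n + 1) i g‖ ^ 2 := by
    have h2 : ∑ i ∈ Finset.range n, ‖gridIncrement 1 (n + 1) (min (i + 1) (n + 1 - 1)) g‖ ^ 2 =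
        ∑ i ∈ Finset.range n, ‖gridIncrement 1 (n + 1) (i + 1) g‖ ^ 2 :=
      Finset.sum_congr rfl fun i hi => by
        rw [min_eq_left]
        have := Finset.mem_range.1 hi
        omega
    have h3 : ‖gridIncrement 1 (n + 1) n g‖ ^ 2 ≤
        ∑ i ∈ Finset.range (n + 1), ‖gridIncrement 1 (n + 1) i g‖ ^ 2 :=
      Finset.single_le_sum (f := fun i => ‖gridIncrement 1 (n + 1) i g‖ ^ 2)
        (fun _ _ => by positivity) (Finset.self_mem_range_succ n)
    have h4 := Finset.sum_range_succ' (fun i => ‖gridIncrement 1 (n + 1) i g‖ ^ 2) n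
    have h5 : 0 ≤ ‖gridIncrement 1 (n + 1) 0 g‖ ^ 2 := by positivity
    rw [Finset.sum_range_succ, h2, min_eq_right (by omega), Nat.add_sub_cancel]
    linarith
  calc _ ≤ ((n + 1 : ℕ) : ℝ) * (2 * ∑ i ∈ Finset.range (n + 1), ‖gridIncrement 1 (n + 1) i g‖ ^ 2) := by
        gcongr
    _ ≤ 2 * ‖g‖ ^ 2 := by linarith

lemma abs_gridPairing_le (n : ℕ) (f g : CameronMartin d) :
    |gridPairing n f g| ≤ 2 * ‖f‖ * ‖g‖ := by
  have h0 : |gridPairing n f g| ≤ n * ∑ i ∈ Finset.range n, ‖gridIncrement 1 n i f‖ *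
      ‖gridIncrement 1 n (min (i + 1) (n - 1)) g‖ := by
    rw [Finset.mul_sum]
    refine (Finset.abs_sum_le_sum_abs _ _).trans (Finset.sum_le_sum fun i _ => ?_)
    rw [abs_mul, Nat.abs_cast]
    gcongr
    exact abs_real_inner_le_norm _ _
  have h1 := Finset.sum_mul_sq_le_sq_mul_sq (Finset.range n) (fun i => ‖gridIncrement 1 n i f‖)
    fun i => ‖gridIncrement 1 n (min (i + 1) (n - 1)) g‖
  have h2 := mul_sum_gridIncrement_sq_le 1 (n := n) f
  have h3 := mul_sum_gridIncrement_shift_sq_le (n := n) g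
  refine h0.trans (abs_le_of_sq_le_sq' ?_ (by positivity)).2
  calc _ ≤ (n * ∑ i ∈ Finset.range n, ‖gridIncrement 1 n i f‖ ^ 2) *
        (n * ∑ i ∈ Finset.range n, ‖gridIncrement 1 n (min (i + 1) (n - 1)) g‖ ^ 2) := by
        rw [mul_pow]
        nlinarith [sq_nonneg (n : ℝ)]
    _ ≤ ‖f‖ ^ 2 * (2 * ‖g‖ ^ 2) := mul_le_mul h2 h3 (by positivity) (by positivity)
    _ ≤ (2 * ‖f‖ * ‖g‖) ^ 2 := by nlinarith [sq_nonneg (‖f‖ * ‖g‖)]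

lemma abs_inner_sub_inner_le {a b x y : Euc d} {ε K M : ℝ} (ha : ‖a - x‖ ≤ ε) (hb : ‖b - y‖ ≤ ε)
    (hM : ‖b‖ ≤ M) (hK : ‖x‖ ≤ K) : |inner ℝ a b - inner ℝ x y| ≤ ε * (M + K) := by
  have h1 : inner ℝ a b - inner ℝ x y = inner ℝ (a - x) b + inner ℝ x (b - y) := by
    rw [inner_sub_left, inner_sub_right]
    ring
  have hε : 0 ≤ ε := (norm_nonneg _).trans ha
  rw [h1, mul_add, mul_comm ε K]
  exact (abs_add_le _ _).trans (add_le_add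
    ((abs_real_inner_le_norm _ _).trans (mul_le_mul ha hM (norm_nonneg _) hε))
    ((abs_real_inner_le_norm _ _).trans
      (mul_le_mul hK hb (norm_nonneg _) ((norm_nonneg _).trans hK))))

lemma norm_setIntegral_sub_smul_le {E : Type*} [NormedAddCommGroup E] [NormedSpace ℝ E]
    [CompleteSpace E] {φ : I → E} (hφ : Continuous φ) {a b : I} (hab : a ≤ b) {y : E} {ε : ℝ}
    (h : ∀ s ∈ Set.Ioc a b, ‖φ s - y‖ ≤ ε) :
    ‖(∫ s in Set.Ioc a b, φ s) - ((b : ℝ) - a) • y‖ ≤ ε * (b - a) := by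
  have hi : Integrable φ := hφ.integrable_of_hasCompactSupport (HasCompactSupport.of_compactSpace φ)
  rw [← volume_real_Ioc hab, ← setIntegral_const,
    ← integral_sub hi.integrableOn (integrable_const _)]
  exact norm_setIntegral_le_of_norm_le_const (measure_lt_top _ _) h

lemma tendsto_gridPairing_continuous (F G : C(I, Euc d)) :
    Tendsto (fun n => gridPairing n (ContinuousMap.toLp 2 volume ℝ F)
      (ContinuousMap.toLp 2 volume ℝ G)) atTop
      (𝓝 (inner ℝ (ContinuousMap.toLp 2 volume ℝ F : CameronMartin d)
        (ContinuousMap.toLp 2 volume ℝ G))) := by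
  set K := ‖F‖
  set M := ‖G‖
  have hF : ∀ s, ‖F s‖ ≤ K := F.norm_coe_le_norm
  have hG : ∀ s, ‖G s‖ ≤ M := G.norm_coe_le_norm
  have hinc : ∀ (H : C(I, Euc d)) n i, gridIncrement 1 n i (ContinuousMap.toLp 2 volume ℝ H) =
      ∫ s in Set.Ioc (gridPoint 1 n i) (gridPoint 1 n (i + 1)), H s := fun H n i => by
    rw [gridIncrement, cmPath_sub_cmPath _ (gridPoint_mono 1 n (Nat.le_succ i))]
    exact integral_congr_ae (ae_restrict_of_ae (ContinuousMap.coeFn_toLp (p := 2) (𝕜 := ℝ) volume H))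
  have hφ : Continuous fun s => (inner ℝ (F s) (G s) : ℝ) := F.continuous.inner G.continuous
  have hφi : Integrable fun s => (inner ℝ (F s) (G s) : ℝ) :=
    hφ.integrable_of_hasCompactSupport (HasCompactSupport.of_compactSpace _)
  have hinner : (inner ℝ (ContinuousMap.toLp 2 volume ℝ F : CameronMartin d)
      (ContinuousMap.toLp 2 volume ℝ G)) = ∫ s : I, (inner ℝ (F s) (G s) : ℝ) := by
    rw [L2.inner_def]
    refine integral_congr_ae ?_
    filter_upwards [ContinuousMap.coeFn_toLp (p := 2) (𝕜 := ℝ) volume F,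
      ContinuousMap.coeFn_toLp (p := 2) (𝕜 := ℝ) volume G] with s h1 h2
    rw [h1, h2]
  rw [hinner, Metric.tendsto_atTop]
  intro ε hε
  obtain ⟨η, hη, hηε⟩ : ∃ η > 0, 2 * (η * (M + K)) < ε :=
    ⟨ε / (4 * (M + K + 1)), by positivity, by
      rw [div_mul_eq_mul_div, ← mul_div_assoc, div_lt_iff₀ (by positivity)]
      nlinarith [norm_nonneg F, norm_nonneg G]⟩
  obtain ⟨δ₁, hδ₁, h₁⟩ := Metric.uniformContinuous_iff.1
    (CompactSpace.uniformContinuous_of_continuous F.continuous) η hη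
  obtain ⟨δ₂, hδ₂, h₂⟩ := Metric.uniformContinuous_iff.1
    (CompactSpace.uniformContinuous_of_continuous G.continuous) η hη
  obtain ⟨n₀, hn₀⟩ := exists_nat_gt (2 / min δ₁ δ₂)
  refine ⟨max n₀ 1, fun n hn => ?_⟩
  have hn1 : 0 < n := lt_of_lt_of_le (by simp) hn
  have hnR : (0 : ℝ) < n := by exact_mod_cast hn1
  have hmesh : 2 / (n : ℝ) < min δ₁ δ₂ := by
    rw [div_lt_comm₀ hnR (lt_min hδ₁ hδ₂)]
    exact hn₀.trans_le (by exact_mod_cast (le_max_left _ _).trans hn)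
  -- Points of the cells `i` and `min (i + 1) (n - 1)` are at distance at most `2 / n`.
  have hclose : ∀ i < n, ∀ j < n, i ≤ j → j ≤ i + 1 →
      ∀ s ∈ Set.Ioc (gridPoint 1 n j) (gridPoint 1 n (j + 1)),
        ‖F s - F (gridPoint 1 n i)‖ ≤ η ∧ ‖G s - G (gridPoint 1 n i)‖ ≤ η := by
    intro i hi j hj hij hji s hs
    have hd : dist s (gridPoint 1 n i) ≤ 2 / n := by
      have h3 := gridPoint_mono 1 n hij
      have h4 : (gridPoint 1 n i : ℝ) ≤ s := (Subtype.coe_le_coe.2 h3).trans hs.1.le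
      have h5 : (s : ℝ) ≤ gridPoint 1 n (j + 1) := hs.2
      rw [gridPoint_coe (by omega)] at h5
      rw [Subtype.dist_eq, Real.dist_eq, abs_of_nonneg (sub_nonneg.2 h4), gridPoint_coe hi.le]
      have h6 : (j : ℝ) ≤ i + 1 := by exact_mod_cast hji
      have h7 : ((j + 1 : ℕ) : ℝ) / n ≤ (i + 2) / n := by
        refine div_le_div_of_nonneg_right ?_ hnR.le
        push_cast
        linarith
      simp only [Set.Icc.coe_one, one_mul] at h5 ⊢
      rw [add_div] at h7
      linarith
    have hd' := hd.trans_lt hmesh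
    constructor
    · rw [← dist_eq_norm]
      exact (h₁ (hd'.trans_le (min_le_left _ _))).le
    · rw [← dist_eq_norm]
      exact (h₂ (hd'.trans_le (min_le_right _ _))).le
  have hcell : ∀ i < n, (gridPoint 1 n (i + 1) : ℝ) - gridPoint 1 n i = (n : ℝ)⁻¹ := fun i hi => by
    rw [gridPoint_succ_sub 1 hi]
    simp
  have haverage : ∀ H : C(I, Euc d), ∀ i < n, ∀ j < n,
      (∀ s ∈ Set.Ioc (gridPoint 1 n j) (gridPoint 1 n (j + 1)),
        ‖H s - H (gridPoint 1 n i)‖ ≤ η) →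
      ‖(n : ℝ) • (∫ s in Set.Ioc (gridPoint 1 n j) (gridPoint 1 n (j + 1)), H s) -
        H (gridPoint 1 n i)‖ ≤ η := fun H i hi j hj h => by
    have h3 := norm_setIntegral_sub_smul_le H.continuous (gridPoint_mono 1 n (Nat.le_succ j)) h
    rw [Nat.succ_eq_add_one, hcell j hj] at h3
    have h4 : (n : ℝ) • (∫ s in Set.Ioc (gridPoint 1 n j) (gridPoint 1 n (j + 1)), H s) -
        H (gridPoint 1 n i) = (n : ℝ) • ((∫ s in Set.Ioc (gridPoint 1 n j) (gridPoint 1 n (j + 1)),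
          H s) - (n : ℝ)⁻¹ • H (gridPoint 1 n i)) := by
      rw [smul_sub, smul_smul, mul_inv_cancel₀ hnR.ne', one_smul]
    rw [h4, norm_smul, Real.norm_natCast]
    calc _ ≤ (n : ℝ) * (η * (n : ℝ)⁻¹) := by gcongr
      _ = η := by field_simp
  have hterm : ∀ i < n, |n * inner ℝ (gridIncrement 1 n i (ContinuousMap.toLp 2 volume ℝ F))
      (gridIncrement 1 n (min (i + 1) (n - 1)) (ContinuousMap.toLp 2 volume ℝ G)) -
      ∫ s in Set.Ioc (gridPoint 1 n i) (gridPoint 1 n (i + 1)), (inner ℝ (F s) (G s) : ℝ)| ≤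
      2 * (η * (M + K)) * (n : ℝ)⁻¹ := by
    intro i hi
    set j := min (i + 1) (n - 1)
    have hj : j < n := by omega
    have hF' := haverage F i hi i hi fun s hs => (hclose i hi i hi le_rfl (by omega) s hs).1
    have hG' := haverage G i hi j hj fun s hs => (hclose i hi j hj (by omega) (by omega) s hs).2
    have hGM : ‖(n : ℝ) • ∫ s in Set.Ioc (gridPoint 1 n j) (gridPoint 1 n (j + 1)), G s‖ ≤ M := by
      have h3 := norm_setIntegral_le_of_norm_le_const (μ := (volume : Measure I))
        (s := Set.Ioc (gridPoint 1 n j) (gridPoint 1 n (j + 1))) (measure_lt_top _ _)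
        fun s _ => hG s
      rw [volume_real_Ioc (gridPoint_mono 1 n (Nat.le_succ j)), hcell j hj] at h3
      rw [norm_smul, Real.norm_natCast]
      calc _ ≤ (n : ℝ) * (M * (n : ℝ)⁻¹) := by gcongr
        _ = M := by field_simp
    have h5 := abs_inner_sub_inner_le hF' hG' hGM (hF (gridPoint 1 n i))
    have h6 := norm_setIntegral_sub_smul_le hφ (gridPoint_mono 1 n (Nat.le_succ i))
      (y := inner ℝ (F (gridPoint 1 n i)) (G (gridPoint 1 n i))) (ε := η * (M + K))
      fun s hs => abs_inner_sub_inner_le (hclose i hi i hi le_rfl (by omega) s hs).1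
        (hclose i hi i hi le_rfl (by omega) s hs).2 (hG s) (hF _)
    rw [Nat.succ_eq_add_one, hcell i hi, smul_eq_mul, Real.norm_eq_abs] at h6
    rw [hinc, hinc]
    rw [real_inner_smul_left, real_inner_smul_right] at h5
    have h7 : |(n : ℝ)⁻¹ * (n * (n * inner ℝ
        (∫ s in Set.Ioc (gridPoint 1 n i) (gridPoint 1 n (i + 1)), F s)
        (∫ s in Set.Ioc (gridPoint 1 n j) (gridPoint 1 n (j + 1)), G s)) -
        inner ℝ (F (gridPoint 1 n i)) (G (gridPoint 1 n i)))| ≤ (n : ℝ)⁻¹ * (η * (M + K)) := by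
      rw [abs_mul, abs_of_nonneg (by positivity : (0 : ℝ) ≤ (n : ℝ)⁻¹)]
      gcongr
    rw [mul_sub, inv_mul_cancel_left₀ hnR.ne'] at h7
    rw [abs_le] at h6 h7 ⊢
    constructor <;> linarith [h6.1, h6.2, h7.1, h7.2]
  have hsum := sum_setIntegral_gridPoint 1 (n := n) hφi.integrableOn n
  rw [gridPoint_self 1 hn1] at hsum
  have huniv : ∫ s : I, (inner ℝ (F s) (G s) : ℝ) =
      ∫ s in Set.Ioc 0 1, (inner ℝ (F s) (G s) : ℝ) := by
    rw [← setIntegral_univ]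
    refine setIntegral_congr_set ?_
    have : (Set.univ : Set I) = Set.Icc 0 1 :=
      (Set.eq_univ_iff_forall.2 fun t => (show t ∈ Set.Icc (0 : I) 1 from ⟨t.2.1, t.2.2⟩)).symm
    rw [this]
    exact Ioc_ae_eq_Icc.symm
  rw [Real.dist_eq, huniv, ← hsum, gridPairing, ← Finset.sum_sub_distrib]
  refine lt_of_le_of_lt ((Finset.abs_sum_le_sum_abs _ _).trans
    (Finset.sum_le_sum fun i hi => hterm i (Finset.mem_range.1 hi))) ?_
  rw [Finset.sum_const, Finset.card_range, nsmul_eq_mul]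
  field_simp
  linarith

lemma tendsto_of_lipschitz_of_dense {X : Type*} [SeminormedAddCommGroup X] {φ : ℕ → X → ℝ}
    {ψ : X → ℝ} {C : ℝ} (hφ : ∀ n x y, |φ n x - φ n y| ≤ C * ‖x - y‖)
    (hψ : ∀ x y, |ψ x - ψ y| ≤ C * ‖x - y‖) {ι : Type*} {e : ι → X} (he : DenseRange e)
    (h : ∀ i, Tendsto (fun n => φ n (e i)) atTop (𝓝 (ψ (e i)))) (x : X) :
    Tendsto (fun n => φ n x) atTop (𝓝 (ψ x)) := by
  rw [Metric.tendsto_atTop]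
  intro ε hε
  obtain ⟨i, hi⟩ := he.exists_dist_lt x (show 0 < ε / (4 * (|C| + 1)) by positivity)
  obtain ⟨n₀, hn₀⟩ := Metric.tendsto_atTop.1 (h i) (ε / 2) (by positivity)
  refine ⟨n₀, fun n hn => ?_⟩
  have h0 : C * ‖x - e i‖ ≤ ε / 4 := by
    rw [← dist_eq_norm]
    calc C * dist x (e i) ≤ (|C| + 1) * dist x (e i) := by
          gcongr
          linarith [le_abs_self C]
      _ ≤ (|C| + 1) * (ε / (4 * (|C| + 1))) := by gcongr
      _ = ε / 4 := by field_simp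
  have h1 := abs_le.1 ((hφ n x (e i)).trans h0)
  have h2 := abs_le.1 ((hψ x (e i)).trans h0)
  have h3 := hn₀ n hn
  rw [Real.dist_eq, abs_lt] at h3 ⊢
  constructor <;> linarith [h1.1, h1.2, h2.1, h2.2, h3.1, h3.2]

/-- The shifted Riemann sums converge to the inner product: they do for continuous densities, and
they are bounded bilinear forms uniformly in `n`. -/
lemma tendsto_gridPairing (f g : CameronMartin d) :
    Tendsto (fun n => gridPairing n f g) atTop (𝓝 (inner ℝ f g)) := by
  have hdense : DenseRange (ContinuousMap.toLp 2 volume ℝ : C(I, Euc d) → CameronMartin d) :=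
    ContinuousMap.toLp_denseRange _ _ ℝ (by norm_num)
  refine tendsto_of_lipschitz_of_dense (φ := fun n f => gridPairing n f g)
    (ψ := fun f => inner ℝ f g) (C := 2 * ‖g‖) (fun n f f' => ?_) (fun f f' => ?_) hdense
    (fun F => ?_) f
  · rw [← gridPairing_sub_left]
    exact (abs_gridPairing_le _ _ _).trans (by linarith)
  · rw [← inner_sub_left]
    refine (abs_real_inner_le_norm _ _).trans ?_
    nlinarith [norm_nonneg (f - f'), norm_nonneg g, mul_nonneg (norm_nonneg (f - f')) (norm_nonneg g)]
  set f := (ContinuousMap.toLp 2 volume ℝ F : CameronMartin d)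
  refine tendsto_of_lipschitz_of_dense (φ := fun n g => gridPairing n f g)
    (ψ := fun g => inner ℝ f g) (C := 2 * ‖f‖) (fun n g g' => ?_) (fun g g' => ?_) hdense
    (fun G => tendsto_gridPairing_continuous F G) g
  · rw [← gridPairing_sub_right]
    exact abs_gridPairing_le _ _ _
  · rw [← inner_sub_right]
    refine (abs_real_inner_le_norm _ _).trans ?_
    nlinarith [norm_nonneg (g - g'), norm_nonneg f, mul_nonneg (norm_nonneg f) (norm_nonneg (g - g'))]

end CameronMartinPaths

/-! ### Processes whose increments are affine in conditional mean -/

section Orthogonality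

variable {d : ℕ} {Ω : Type*} {m : MeasurableSpace Ω} {P : Measure Ω} {𝓕 : Filtration I m}

lemma aestronglyMeasurable_cmPath {h : Ω → CameronMartin d} (hh : AEStronglyMeasurable h P) (t : I) :
    AEStronglyMeasurable (fun ω => cmPath (h ω) t) P :=
  (cmEval t).continuous.comp_aestronglyMeasurable hh

lemma memLp_cmPath {h : Ω → CameronMartin d} (hh : MemLp h 2 P) (t : I) :
    MemLp (fun ω => cmPath (h ω) t) 2 P :=
  hh.mono (aestronglyMeasurable_cmPath hh.1 t) (.of_forall fun ω => norm_cmPath_apply_le (h ω) t)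

lemma integrable_inner_of_memLp_two {E : Type*} [NormedAddCommGroup E] [InnerProductSpace ℝ E]
    {f g : Ω → E} (hf : MemLp f 2 P) (hg : MemLp g 2 P) :
    Integrable (fun ω => (inner ℝ (f ω) (g ω) : ℝ)) P :=
  (hf.norm.integrable_mul hg.norm).mono' (hf.1.inner hg.1)
    (.of_forall fun _ => norm_inner_le_norm _ _)

variable [IsProbabilityMeasure P]

lemma integrable_cmPath {h : Ω → CameronMartin d} (hh : MemLp h 2 P) (t : I) :
    Integrable (fun ω => cmPath (h ω) t) P :=
  (memLp_cmPath hh t).integrable (by norm_num)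

lemma integrable_cmPath_sub {h : Ω → CameronMartin d} (hh : MemLp h 2 P) (s t : I) :
    Integrable (fun ω => cmPath (h ω) t - cmPath (h ω) s) P :=
  (integrable_cmPath hh t).sub (integrable_cmPath hh s)

lemma continuous_setIntegral_cmPath {h : Ω → CameronMartin d} (hh : MemLp h 2 P) (B : Set Ω) :
    Continuous fun t => ∫ ω in B, cmPath (h ω) t ∂P :=
  continuous_of_dominated (fun t => (aestronglyMeasurable_cmPath hh.1 t).restrict)
    (fun t => .of_forall fun ω => norm_cmPath_apply_le (h ω) t)
    (hh.integrable (by norm_num)).norm.integrableOn (.of_forall fun ω => (cmPath (h ω)).continuous)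

/-- A square integrable variable with vanishing integral over the sets of a sub-sigma-field is
orthogonal to the square integrable variables measurable for that sigma-field. -/
lemma integral_inner_eq_zero_of_setIntegral_eq_zero {𝓖 : MeasurableSpace Ω} (h𝓖 : 𝓖 ≤ m)
    {F X : Ω → Euc d} (hF : MemLp F 2 P) (hFm : StronglyMeasurable[𝓖] F) (hX : MemLp X 2 P)
    (h : ∀ B, MeasurableSet[𝓖] B → ∫ ω in B, X ω ∂P = 0) :
    ∫ ω, (inner ℝ (F ω) (X ω) : ℝ) ∂P = 0 := by
  have hXi := hX.integrable (q := 2) (by norm_num)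
  have h0 : (0 : Ω → Euc d) =ᵐ[P] P[X | 𝓖] :=
    ae_eq_condExp_of_forall_setIntegral_eq h𝓖 hXi (fun _ _ _ => integrableOn_zero)
      (fun B hB _ => by simp [h B hB]) aestronglyMeasurable_zero
  rw [← integral_condExp h𝓖]
  refine integral_eq_zero_of_ae ?_
  filter_upwards [condExp_bilin_of_stronglyMeasurable_left (m := 𝓖) (innerSL ℝ) hFm
    (show Integrable (fun ω => (innerSL ℝ (F ω)) (X ω)) P from integrable_inner_of_memLp_two hF hX) hXi, h0]
    with ω h1 h2
  refine h1.trans ?_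
  rw [← h2]
  simp

/-- The random path `Z` of `ζ` satisfies `𝔼[Z_b - Z_s | 𝓕_s] = (b - s) / (1 - s) 𝔼[Z_1 - Z_s | 𝓕_s]`:
given the past, its future increments are on average proportional to the elapsed time. -/
def HasAffineIncrements (𝓕 : Filtration I m) (P : Measure Ω) (ζ : Ω → CameronMartin d) : Prop :=
  ∀ s b : I, s ≤ b → ∀ B, MeasurableSet[𝓕 s] B →
    (1 - s : ℝ) • ∫ ω in B, (cmPath (ζ ω) b - cmPath (ζ ω) s) ∂P =
      (b - s : ℝ) • ∫ ω in B, (cmPath (ζ ω) 1 - cmPath (ζ ω) s) ∂P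

lemma HasAffineIncrements.integral_inner_eq {ζ : Ω → CameronMartin d}
    (hA : HasAffineIncrements 𝓕 P ζ) (hζ : MemLp ζ 2 P) {F : Ω → Euc d} (hF : MemLp F 2 P)
    {s a b a' b' : I} (hs : s < 1) (hFm : StronglyMeasurable[𝓕 s] F) (hsa : s ≤ a) (hsb : s ≤ b)
    (hsa' : s ≤ a') (hsb' : s ≤ b') (hab : (b : ℝ) - a = b' - a') :
    ∫ ω, (inner ℝ (F ω) (cmPath (ζ ω) b - cmPath (ζ ω) a) : ℝ) ∂P =
      ∫ ω, (inner ℝ (F ω) (cmPath (ζ ω) b' - cmPath (ζ ω) a') : ℝ) ∂P := by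
  have hL : ∀ u v, MemLp (fun ω => cmPath (ζ ω) u - cmPath (ζ ω) v) 2 P := fun u v =>
    (memLp_cmPath hζ u).sub (memLp_cmPath hζ v)
  have hI : ∀ u v, Integrable (fun ω => cmPath (ζ ω) u - cmPath (ζ ω) v) P := fun u v =>
    (hL u v).integrable (by norm_num)
  have hincr : ∀ u v : I, s ≤ u → s ≤ v → ∀ B, MeasurableSet[𝓕 s] B →
      (1 - s : ℝ) • ∫ ω in B, (cmPath (ζ ω) v - cmPath (ζ ω) u) ∂P =
        (v - u : ℝ) • ∫ ω in B, (cmPath (ζ ω) 1 - cmPath (ζ ω) s) ∂P := by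
    intro u v hu hv B hB
    have h1 : ∫ ω in B, (cmPath (ζ ω) v - cmPath (ζ ω) u) ∂P =
        (∫ ω in B, (cmPath (ζ ω) v - cmPath (ζ ω) s) ∂P) -
          ∫ ω in B, (cmPath (ζ ω) u - cmPath (ζ ω) s) ∂P := by
      rw [← integral_sub (hI _ _).integrableOn (hI _ _).integrableOn]
      simp
    rw [h1, smul_sub, hA s v hv B hB, hA s u hu B hB, ← sub_smul]
    congr 1
    ring
  rw [← sub_eq_zero, ← integral_sub (integrable_inner_of_memLp_two hF (hL _ _))
    (integrable_inner_of_memLp_two hF (hL _ _))]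
  simp_rw [← inner_sub_right]
  refine integral_inner_eq_zero_of_setIntegral_eq_zero (𝓕.le s) hF hFm ((hL _ _).sub (hL _ _))
    fun B hB => ?_
  rw [integral_sub (hI _ _).integrableOn (hI _ _).integrableOn, sub_eq_zero]
  have hs0 : (1 - s : ℝ) ≠ 0 := (sub_pos.2 (show (s : ℝ) < 1 from hs)).ne'
  refine smul_right_injective _ hs0 ?_
  simp only
  rw [hincr a b hsa hsb B hB, hincr a' b' hsa' hsb' B hB, hab]

/-- A process with affine mean increments is orthogonal to the adapted processes that vanish at
time `1`. In the Riemann sum `gridPairing`, each increment of `h` meets an increment of `ζ` over a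
later cell, which may be replaced by the last cell; the sum telescopes to `h_1 = 0`. -/
theorem HasAffineIncrements.integral_inner_eq_zero {ζ h : Ω → CameronMartin d}
    (hA : HasAffineIncrements 𝓕 P ζ) (hζ : MemLp ζ 2 P) (hh : MemLp h 2 P)
    (hadapted : ∀ t, Measurable[𝓕 t] fun ω => cmPath (h ω) t)
    (h1 : ∀ᵐ ω ∂P, cmPath (h ω) 1 = 0) : ∫ ω, (inner ℝ (h ω) (ζ ω) : ℝ) ∂P = 0 := by
  have hL : ∀ n i, MemLp (fun ω => gridIncrement 1 n i (h ω)) 2 P := fun n i =>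
    (memLp_cmPath hh _).sub (memLp_cmPath hh _)
  have hLζ : ∀ n i, MemLp (fun ω => gridIncrement 1 n i (ζ ω)) 2 P := fun n i =>
    (memLp_cmPath hζ _).sub (memLp_cmPath hζ _)
  have hint : ∀ n i j, Integrable (fun ω =>
      n * (inner ℝ (gridIncrement 1 n i (h ω)) (gridIncrement 1 n j (ζ ω)) : ℝ)) P := fun n i j =>
    (integrable_inner_of_memLp_two (hL n i) (hLζ n j)).const_mul _
  have hzero : ∀ n, 1 ≤ n → ∫ ω, gridPairing n (h ω) (ζ ω) ∂P = 0 := by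
    intro n hn
    have hterm : ∀ i ∈ Finset.range n, ∫ ω, n * (inner ℝ (gridIncrement 1 n i (h ω))
        (gridIncrement 1 n (min (i + 1) (n - 1)) (ζ ω)) : ℝ) ∂P =
        ∫ ω, n * (inner ℝ (gridIncrement 1 n i (h ω)) (gridIncrement 1 n (n - 1) (ζ ω)) : ℝ) ∂P := by
      intro i hi
      rw [integral_const_mul, integral_const_mul]
      rcases (show i + 1 ≤ n from Finset.mem_range.1 hi).eq_or_lt with hin | hin
      · rw [min_eq_right (by omega)]
      congr 1
      rw [min_eq_left (by omega)]
      have hs : gridPoint 1 n (i + 1) < 1 := by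
        refine Subtype.coe_lt_coe.1 ?_
        have hnR : (0 : ℝ) < n := by exact_mod_cast hn
        rw [gridPoint_coe hin.le, Set.Icc.coe_one, one_mul, div_lt_one hnR]
        exact_mod_cast hin
      refine hA.integral_inner_eq hζ (hL n i) hs ?_ le_rfl
        (gridPoint_mono 1 n (by omega)) (gridPoint_mono 1 n (by omega))
        (gridPoint_mono 1 n (by omega)) ?_
      · exact ((hadapted _).sub ((hadapted _).mono (𝓕.mono (gridPoint_mono 1 n (by omega)))
          le_rfl)).stronglyMeasurable
      · rw [gridPoint_succ_sub 1 hin, gridPoint_succ_sub 1 (by omega)]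
    simp only [gridPairing]
    rw [integral_finsetSum _ fun i _ => hint n i _, Finset.sum_congr rfl hterm,
      ← integral_finsetSum _ fun i _ => hint n i _]
    refine integral_eq_zero_of_ae ?_
    filter_upwards [h1] with ω hω
    rw [← Finset.mul_sum, ← sum_inner]
    simp only [gridIncrement]
    rw [Finset.sum_range_sub (fun i => cmPath (h ω) (gridPoint 1 n i)), gridPoint_zero,
      gridPoint_self 1 hn, hω, cmPath_zero]
    simp
  have hlim : Tendsto (fun n => ∫ ω, gridPairing n (h ω) (ζ ω) ∂P) atTop
      (𝓝 (∫ ω, (inner ℝ (h ω) (ζ ω) : ℝ) ∂P)) := by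
    refine tendsto_integral_of_dominated_convergence (fun ω => 2 * (‖h ω‖ * ‖ζ ω‖)) (fun n => ?_)
      ((hh.norm.integrable_mul hζ.norm).const_mul 2) (fun n => .of_forall fun ω => ?_)
      (.of_forall fun ω => tendsto_gridPairing _ _)
    · exact (integrable_finsetSum _ fun i _ => hint n i _).1
    · rw [Real.norm_eq_abs, ← mul_assoc]
      exact abs_gridPairing_le _ _ _
  refine tendsto_nhds_unique hlim (tendsto_const_nhds.congr' ?_)
  filter_upwards [eventually_ge_atTop 1] with n hn using (hzero n hn).symm

/-- It suffices to compare the mean increments over two consecutive disjoint intervals that start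
strictly after the time `s`. -/
lemma hasAffineIncrements_of_slope_eq {ζ : Ω → CameronMartin d} (hζ : MemLp ζ 2 P)
    (h : ∀ s a b c e : I, s < a → a < b → b ≤ c → c < e → ∀ B, MeasurableSet[𝓕 s] B →
      (b - a : ℝ)⁻¹ • ∫ ω in B, (cmPath (ζ ω) b - cmPath (ζ ω) a) ∂P =
        (e - c : ℝ)⁻¹ • ∫ ω in B, (cmPath (ζ ω) e - cmPath (ζ ω) c) ∂P) :
    HasAffineIncrements 𝓕 P ζ := by
  intro s b hsb B hB
  set φ : I → Euc d := fun t => ∫ ω in B, cmPath (ζ ω) t ∂P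
  have hφ : Continuous φ := continuous_setIntegral_cmPath hζ B
  have hsub : ∀ u v, ∫ ω in B, (cmPath (ζ ω) v - cmPath (ζ ω) u) ∂P = φ v - φ u := fun u v =>
    integral_sub (integrable_cmPath hζ v).integrableOn (integrable_cmPath hζ u).integrableOn
  simp_rw [hsub]
  rcases hsb.eq_or_lt with rfl | hsb'
  · simp
  rcases (show b ≤ 1 from b.2.2).eq_or_lt with rfl | hb1
  · rfl
  -- The identity holds with `a ∈ (s, b)` in place of `s`; then `a` decreases to `s`.
  have hslope : ∀ a ∈ Set.Ioo s b, (1 - a : ℝ) • (φ b - φ a) = (b - a : ℝ) • (φ 1 - φ a) := by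
    intro a ha
    have h0 : (0 : ℝ) < b - a := sub_pos.2 ha.2
    have h1 : (0 : ℝ) < 1 - b := sub_pos.2 hb1
    have h2 := h s a b b 1 ha.1 ha.2 le_rfl hb1 B hB
    rw [hsub, hsub] at h2
    have h3 : (1 - b : ℝ) • (φ b - φ a) = (b - a : ℝ) • (φ 1 - φ b) := by
      have h4 := congrArg (fun x => ((1 - b : ℝ) * (b - a)) • x) h2
      simp only [smul_smul, Set.Icc.coe_one] at h4
      rwa [mul_assoc, mul_inv_cancel₀ h0.ne', mul_one, mul_right_comm, mul_inv_cancel₀ h1.ne',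
        one_mul] at h4
    calc (1 - a : ℝ) • (φ b - φ a) = (1 - b : ℝ) • (φ b - φ a) + (b - a : ℝ) • (φ b - φ a) := by
          rw [← add_smul]; congr 1; ring
      _ = (b - a : ℝ) • (φ 1 - φ a) := by rw [h3, ← smul_add]; congr 1; abel
  have hcoe : Continuous ((↑) : I → ℝ) := continuous_subtype_val
  have hclosed : IsClosed {a : I | (1 - a : ℝ) • (φ b - φ a) = (b - a : ℝ) • (φ 1 - φ a)} :=
    isClosed_eq ((continuous_const.sub hcoe).smul (continuous_const.sub hφ))
      ((continuous_const.sub hcoe).smul (continuous_const.sub hφ))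
  have hmem := closure_minimal hslope hclosed
  rw [closure_Ioo hsb'.ne] at hmem
  exact hmem ⟨le_rfl, hsb⟩

end Orthogonality

/-! ### Riemann sums of càdlàg paths -/

/-- The right end point of the cell of the uniform grid of `[0,T]` that contains `s`. -/
noncomputable def gridCeil (T : I) (n : ℕ) (s : I) : I :=
  gridPoint T n ⌈(n * s / T : ℝ)⌉₊

lemma gridCeil_le (T : I) (n : ℕ) (s : I) : gridCeil T n s ≤ T := gridPoint_le _ _ _

lemma measurable_gridIndex (T : I) (n : ℕ) : Measurable fun s : I => ⌈(n * s / T : ℝ)⌉₊ :=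
  Nat.measurable_ceil.comp ((measurable_subtype_coe.const_mul _).div_const _)

lemma measurable_comp_gridCeil (T : I) (n : ℕ) {E : Type*} [MeasurableSpace E] (φ : I → E) :
    Measurable fun s : I => φ (gridCeil T n s) := by
  have h1 : Measurable fun k : ℕ => φ (gridPoint T n k) := measurable_from_nat
  have h2 := h1.comp (measurable_gridIndex T n)
  simp only [Function.comp_def] at h2
  unfold gridCeil
  exact h2

lemma measurable_uncurry_gridCeil (T : I) (n : ℕ) {Ω E : Type*} [MeasurableSpace Ω]
    [MeasurableSpace E] {N : I → Ω → E} (hN : ∀ t ≤ T, Measurable (N t)) :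
    Measurable fun p : Ω × I => N (gridCeil T n p.2) p.1 := by
  have h1 : Measurable fun p : ℕ × Ω => N (gridPoint T n p.1) p.2 :=
    measurable_from_prod_countable_right fun k => hN _ (gridPoint_le T n k)
  have h2 : Measurable fun p : Ω × I => (⌈(n * p.2 / T : ℝ)⌉₊, p.1) :=
    ((measurable_gridIndex T n).comp measurable_snd).prodMk measurable_fst
  have h3 := h1.comp h2
  simp only [Function.comp_def] at h3
  unfold gridCeil
  exact h3

lemma gridCeil_coe {T : I} (hT : 0 < T) {n : ℕ} {s : I} (hs : s ≤ T) :
    (gridCeil T n s : ℝ) = T * (⌈(n * s / T : ℝ)⌉₊ / n) := by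
  have hT' : (0 : ℝ) < T := hT
  refine gridPoint_coe (Nat.ceil_le.2 ?_) T
  rw [div_le_iff₀ hT']
  exact mul_le_mul_of_nonneg_left hs (Nat.cast_nonneg n)

lemma le_gridCeil {T : I} (hT : 0 < T) {n : ℕ} (hn : 0 < n) {s : I} (hs : s ≤ T) :
    s ≤ gridCeil T n s := by
  have hT' : (0 : ℝ) < T := hT
  have hn' : (0 : ℝ) < n := by exact_mod_cast hn
  refine Subtype.coe_le_coe.1 ?_
  rw [gridCeil_coe hT hs, ← mul_div_assoc, le_div_iff₀ hn']
  have := Nat.le_ceil (n * s / T : ℝ)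
  rw [div_le_iff₀ hT'] at this
  linarith

lemma gridCeil_le_add {T : I} (hT : 0 < T) {n : ℕ} (hn : 0 < n) {s : I} (hs : s ≤ T) :
    (gridCeil T n s : ℝ) ≤ s + 1 / n := by
  have hT' : (0 : ℝ) < T := hT
  have hn' : (0 : ℝ) < n := by exact_mod_cast hn
  rw [gridCeil_coe hT hs, ← mul_div_assoc, div_le_iff₀ hn', add_mul, one_div,
    inv_mul_cancel₀ hn'.ne']
  have h0 : (0 : ℝ) ≤ n * s / T := div_nonneg (mul_nonneg hn'.le s.2.1) hT'.le
  have h1 := Nat.ceil_lt_add_one h0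
  have h2 : (T : ℝ) * ⌈(n * s / T : ℝ)⌉₊ ≤ T * (n * s / T + 1) := by gcongr
  have h3 : (T : ℝ) * (n * s / T + 1) = n * s + T := by field_simp
  linarith [T.2.2]

lemma tendsto_gridCeil {T : I} (hT : 0 < T) {s : I} (hs : s ≤ T) :
    Tendsto (fun n => gridCeil T n s) atTop (𝓝[≥] s) := by
  refine tendsto_nhdsWithin_iff.2 ⟨?_, ?_⟩
  · rw [tendsto_subtype_rng]
    have h1 : Tendsto (fun n : ℕ => (s : ℝ) + 1 / n) atTop (𝓝 (s + 0)) :=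
      tendsto_const_nhds.add tendsto_one_div_atTop_nhds_zero_nat
    rw [add_zero] at h1
    refine tendsto_of_tendsto_of_tendsto_of_le_of_le' tendsto_const_nhds h1 ?_ ?_
    · filter_upwards [eventually_gt_atTop 0] with n hn using le_gridCeil hT hn hs
    · filter_upwards [eventually_gt_atTop 0] with n hn using gridCeil_le_add hT hn hs
  · filter_upwards [eventually_gt_atTop 0] with n hn using le_gridCeil hT hn hs

lemma gridCeil_eq {T : I} (hT : 0 < T) {n i : ℕ} (hi : i < n) {s : I}
    (hs : s ∈ Set.Ioc (gridPoint T n i) (gridPoint T n (i + 1))) :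
    gridCeil T n s = gridPoint T n (i + 1) := by
  have hT' : (0 : ℝ) < T := hT
  have hn' : (0 : ℝ) < n := by exact_mod_cast (Nat.zero_lt_of_lt hi)
  have h1 : (gridPoint T n i : ℝ) < s := hs.1
  have h2 : (s : ℝ) ≤ gridPoint T n (i + 1) := hs.2
  rw [gridPoint_coe hi.le, ← mul_div_assoc, div_lt_iff₀ hn'] at h1
  rw [gridPoint_coe hi, ← mul_div_assoc, le_div_iff₀ hn'] at h2
  rw [gridCeil, (Nat.ceil_eq_iff (Nat.succ_ne_zero i)).2 ⟨?_, ?_⟩]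
  · rw [lt_div_iff₀ hT', Nat.succ_sub_one]
    linarith
  · rw [div_le_iff₀ hT']
    linarith

section Cadlag

variable {d : ℕ} {φ : I → Euc d}

lemma exists_bound_of_cadlag (hr : ∀ t < (1 : I), ContinuousWithinAt φ (Set.Ici t) t)
    (hl : ∀ t < (1 : I), ∃ l, Tendsto φ (𝓝[<] t) (𝓝 l)) {T : I} (hT : T < 1) :
    ∃ C, ∀ s ≤ T, ‖φ s‖ ≤ C := by
  have hev : ∀ {l : Filter I} {y}, Tendsto φ l (𝓝 y) → ∃ C, ∀ᶠ s in l, ‖φ s‖ ≤ C :=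
    fun {l y} h => ⟨‖y‖ + 1, (h.norm.eventually (gt_mem_nhds (lt_add_one _))).mono
      fun s hs => hs.le⟩
  refine (isCompact_Icc (a := 0) (b := T)).induction_on (p := fun S => ∃ C, ∀ s ∈ S, ‖φ s‖ ≤ C)
    ⟨0, by simp⟩ (fun S S' hS ⟨C, hC⟩ => ⟨C, fun s hs => hC s (hS hs)⟩)
    (fun S S' ⟨C, hC⟩ ⟨C', hC'⟩ => ⟨max C C', ?_⟩) (fun t ht => ?_) |>.imp
      fun C hC s hs => hC s ⟨s.2.1, hs⟩
  · rintro s (hs | hs)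
    · exact (hC s hs).trans (le_max_left _ _)
    · exact (hC' s hs).trans (le_max_right _ _)
  · have ht1 : t < 1 := ht.2.trans_lt hT
    obtain ⟨l, hl⟩ := hl t ht1
    obtain ⟨C, hC⟩ := hev hl
    obtain ⟨C', hC'⟩ := hev (hr t ht1)
    refine ⟨{s | ‖φ s‖ ≤ max C C'}, mem_nhdsWithin_of_mem_nhds ?_, max C C', fun s hs => hs⟩
    rw [← nhdsLT_sup_nhdsGE]
    exact ⟨hC.mono fun s hs => hs.trans (le_max_left _ _),
      hC'.mono fun s hs => hs.trans (le_max_right _ _)⟩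

lemma aestronglyMeasurable_of_rightContinuous
    (hr : ∀ t < (1 : I), ContinuousWithinAt φ (Set.Ici t) t) {T : I} (hT0 : 0 < T) (hT : T < 1) :
    AEStronglyMeasurable φ (volume.restrict (Set.Ioc 0 T)) := by
  refine aestronglyMeasurable_of_tendsto_ae atTop (f := fun n s => φ (gridCeil T n s))
    (fun n => ?_) ?_
  · exact (measurable_comp_gridCeil T n φ).aestronglyMeasurable
  · filter_upwards [ae_restrict_mem measurableSet_Ioc] with s hs
    exact (hr s (hs.2.trans_lt hT)).tendsto.comp (tendsto_gridCeil hT0 hs.2)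

lemma integrableOn_of_cadlag (hr : ∀ t < (1 : I), ContinuousWithinAt φ (Set.Ici t) t)
    (hl : ∀ t < (1 : I), ∃ l, Tendsto φ (𝓝[<] t) (𝓝 l)) {T : I} (hT0 : 0 < T) (hT : T < 1) :
    IntegrableOn φ (Set.Ioc 0 T) := by
  obtain ⟨C, hC⟩ := exists_bound_of_cadlag hr hl hT
  refine Integrable.of_bound (aestronglyMeasurable_of_rightContinuous hr hT0 hT) C ?_
  filter_upwards [ae_restrict_mem measurableSet_Ioc] with s hs using hC s hs.2

lemma tendsto_sum_gridPoint (hr : ∀ t < (1 : I), ContinuousWithinAt φ (Set.Ici t) t)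
    (hl : ∀ t < (1 : I), ∃ l, Tendsto φ (𝓝[<] t) (𝓝 l)) {T : I} (hT0 : 0 < T) (hT : T < 1) :
    Tendsto (fun n : ℕ => ∑ i ∈ Finset.range n, (T / n : ℝ) • φ (gridPoint T n i)) atTop
      (𝓝 (∫ s in Set.Ioc 0 T, φ s)) := by
  obtain ⟨C, hC⟩ := exists_bound_of_cadlag hr hl hT
  have hmeas : ∀ n, AEStronglyMeasurable (fun s => φ (gridCeil T n s))
      (volume.restrict (Set.Ioc 0 T)) := fun n =>
    (measurable_comp_gridCeil T n φ).aestronglyMeasurable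
  have h1 : Tendsto (fun n => ∫ s in Set.Ioc 0 T, φ (gridCeil T n s)) atTop
      (𝓝 (∫ s in Set.Ioc 0 T, φ s)) := by
    refine tendsto_integral_of_dominated_convergence (fun _ => C) hmeas (integrable_const _)
      (fun n => .of_forall fun s => hC _ (gridCeil_le T n s)) ?_
    filter_upwards [ae_restrict_mem measurableSet_Ioc] with s hs
    exact (hr s (hs.2.trans_lt hT)).tendsto.comp (tendsto_gridCeil hT0 hs.2)
  have h2 : ∀ n : ℕ, 0 < n → ∫ s in Set.Ioc 0 T, φ (gridCeil T n s) =
      (∑ i ∈ Finset.range n, (T / n : ℝ) • φ (gridPoint T n i)) + (T / n : ℝ) • (φ T - φ 0) := by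
    intro n hn
    have h3 := sum_setIntegral_gridPoint T (n := n) (f := fun s => φ (gridCeil T n s))
      (Integrable.of_bound (hmeas n) C (.of_forall fun s => hC _ (gridCeil_le T n s))) n
    rw [gridPoint_self T hn] at h3
    have h4 := Finset.sum_range_sub (fun i => φ (gridPoint T n i)) n
    rw [gridPoint_self T hn, gridPoint_zero] at h4
    rw [← h3, ← h4, Finset.smul_sum, ← Finset.sum_add_distrib]
    refine Finset.sum_congr rfl fun i hi => ?_
    have hi := Finset.mem_range.1 hi
    rw [setIntegral_congr_fun measurableSet_Ioc
      (fun s hs => by simp only [gridCeil_eq hT0 hi hs] : Set.EqOn (fun s => φ (gridCeil T n s))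
        (fun _ => φ (gridPoint T n (i + 1))) _), setIntegral_const,
      volume_real_Ioc (gridPoint_mono T n (Nat.le_succ i)), Nat.succ_eq_add_one,
      gridPoint_succ_sub T hi, smul_sub]
    abel
  have h5 : Tendsto (fun n : ℕ => (T / n : ℝ) • (φ T - φ 0)) atTop (𝓝 0) := by
    simpa using (tendsto_const_div_atTop_nhds_zero_nat (T : ℝ)).smul_const (φ T - φ 0)
  have h6 := h1.sub h5
  rw [sub_zero] at h6
  refine h6.congr' ?_
  filter_upwards [eventually_gt_atTop 0] with n hn
  rw [h2 n hn, add_sub_cancel_right]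

lemma continuous_integral_Iic {f : I → Euc d} (hf : Integrable f) :
    Continuous fun t : I => ∫ s in Set.Iic t, f s := by
  simp_rw [← integral_indicator measurableSet_Iic]
  refine continuous_iff_continuousAt.2 fun t₀ =>
    continuousAt_of_dominated (bound := fun s => ‖f s‖) ?_ ?_ hf.norm ?_
  · exact .of_forall fun t => (hf.indicator measurableSet_Iic).aestronglyMeasurable
  · exact .of_forall fun t => .of_forall fun s => norm_indicator_le_norm_self _ _
  · have h0 : ∀ᵐ s : I, s ≠ t₀ := by simp [ae_iff]
    filter_upwards [h0] with s hs
    rcases lt_or_gt_of_ne hs with hlt | hgt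
    · refine (continuousAt_const (y := f s)).congr ?_
      filter_upwards [lt_mem_nhds hlt] with t ht
      exact (Set.indicator_of_mem (Set.mem_Iic.2 ht.le) _).symm
    · refine (continuousAt_const (y := (0 : Euc d))).congr ?_
      filter_upwards [gt_mem_nhds hgt] with t ht
      exact (Set.indicator_of_notMem (by simpa using ht) _).symm

lemma Iic_eq_union_Ioc (t : I) : Set.Iic t = {0} ∪ Set.Ioc 0 t := by
  ext s
  simp only [Set.mem_Iic, Set.mem_union, Set.mem_singleton_iff, Set.mem_Ioc]
  exact ⟨fun h => (show 0 ≤ s from s.2.1).eq_or_lt.imp Eq.symm fun h0 => ⟨h0, h⟩, fun h =>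
    h.elim (fun h => h ▸ t.2.1) fun h => h.2⟩

lemma Iic_ae_eq_Ioc (t : I) : Set.Iic t =ᵐ[volume] Set.Ioc 0 t := by
  rw [Iic_eq_union_Ioc]
  exact union_ae_eq_right_of_ae_eq_empty (by simp [ae_eq_empty])

/-- A càdlàg path on `[0,1)` whose integrals over `[0,t]` are those of `f` for a dense set of times
`t` is almost everywhere equal to `f`. -/
lemma ae_eq_of_dense_integral_eq {f : I → Euc d} (hf : Integrable f)
    (hr : ∀ t < (1 : I), ContinuousWithinAt φ (Set.Ici t) t)
    (hl : ∀ t < (1 : I), ∃ l, Tendsto φ (𝓝[<] t) (𝓝 l)) {D : Set I} (hD : Dense D)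
    (h : ∀ t ∈ D, 0 < t → t < 1 → ∫ s in Set.Iic t, f s = ∫ s in Set.Ioc 0 t, φ s) :
    f =ᵐ[volume] φ := by
  have hT : ∀ T : I, 0 < T → T < 1 → ∀ᵐ s : I, s ≤ T → f s = φ s := by
    intro T hT0 hT1
    have hφi : IntegrableOn φ (Set.Iic T) :=
      (integrableOn_congr_set_ae (Iic_ae_eq_Ioc T)).2 (integrableOn_of_cadlag hr hl hT0 hT1)
    set g := (Set.Iic T).indicator fun s => f s - φ s
    have hg : Integrable g :=
      (integrable_indicator_iff measurableSet_Iic).2 (hf.integrableOn.sub hφi)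
    have hgT : ∀ t, ∫ s in Set.Iic t, g s = ∫ s in Set.Iic (min t T), (f s - φ s) := fun t => by
      rw [setIntegral_indicator measurableSet_Iic, Set.Iic_inter_Iic]
    have hzero : ∀ t ∈ Set.Icc 0 T, ∫ s in Set.Iic t, g s = 0 := by
      have hcl : IsClosed {t | ∫ s in Set.Iic t, g s = 0} :=
        isClosed_eq (continuous_integral_Iic hg) continuous_const
      have h1 : Set.Ioo 0 T ∩ D ⊆ {t | ∫ s in Set.Iic t, g s = 0} := fun t ht => by
        change ∫ s in Set.Iic t, g s = 0
        rw [hgT, min_eq_left ht.1.2.le, integral_sub hf.integrableOn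
          (hφi.mono_set (Set.Iic_subset_Iic.2 ht.1.2.le)),
          h t ht.2 ht.1.1 (ht.1.2.trans hT1), setIntegral_congr_set (Iic_ae_eq_Ioc t), sub_self]
      intro t ht
      have h2 := closure_minimal ((hD.open_subset_closure_inter isOpen_Ioo).trans
        (closure_minimal h1 hcl)) hcl
      rw [closure_Ioo hT0.ne] at h2
      exact h2 ht
    have h0 := ae_eq_zero_of_forall_integral_Iic_eq_zero hg fun t => by
      rw [hgT, ← min_self T, ← min_assoc, ← hgT]
      exact hzero _ ⟨le_min t.2.1 T.2.1, min_le_right _ _⟩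
    filter_upwards [h0] with s hs hsT
    exact sub_eq_zero.1 ((Set.indicator_of_mem (Set.mem_Iic.2 hsT) _).symm.trans hs)
  obtain ⟨u, -, hu1, hu⟩ := exists_seq_strictMono_tendsto' (show (0 : I) < 1 from zero_lt_one)
  have hone : ∀ᵐ s : I, s ≠ 1 := by simp [ae_iff]
  filter_upwards [hone, ae_all_iff.2 fun n => hT (u n) (hu1 n).1 (hu1 n).2] with s hs h
  have hs1 : s < 1 := lt_of_le_of_ne s.2.2 hs
  obtain ⟨n, hn⟩ := (hu.eventually (lt_mem_nhds hs1)).exists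
  exact h n hn.le

end Cadlag

/-! ### Affine mean increments and martingale densities -/

section MartingaleDensity

variable {d : ℕ} {Ω : Type*} {m : MeasurableSpace Ω} {P : Measure Ω} {𝓕 : Filtration I m}
  [IsProbabilityMeasure P]

/-- A process whose density is a martingale has affine mean increments, by Fubini's theorem. -/
theorem hasAffineIncrements_of_martingale {ζ : Ω → CameronMartin d} (hζ : MemLp ζ 2 P)
    {N : I → Ω → Euc d} (hN : Martingale (fun t : Set.Iio (1 : I) => N t) (beforeOne 𝓕) P)
    (hr : ∀ ω, ∀ t < (1 : I), ContinuousWithinAt (fun s => N s ω) (Set.Ici t) t)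
    (h : ∀ᵐ ω ∂P, Integrable (fun s => N s ω) (volume : Measure I) ∧
      ∀ t : I, cmPath (ζ ω) t = ∫ s in Set.Iic t, N s ω) :
    HasAffineIncrements 𝓕 P ζ := by
  have hNm : ∀ t < (1 : I), StronglyMeasurable[𝓕 t] (N t) := fun t ht => hN.1 ⟨t, ht⟩
  have hNi : ∀ t < (1 : I), Integrable (N t) P := fun t ht => hN.integrable ⟨t, ht⟩
  have hNc : ∀ s t : I, s ≤ t → t < 1 → P[N t | 𝓕 s] =ᵐ[P] N s := fun s t hst ht =>
    hN.2 ⟨s, hst.trans_lt ht⟩ ⟨t, ht⟩ hst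
  have hlt : ∀ s b : I, s < b → b < 1 → ∀ B, MeasurableSet[𝓕 s] B →
      ∫ ω in B, (cmPath (ζ ω) b - cmPath (ζ ω) s) ∂P = (b - s : ℝ) • ∫ ω in B, N s ω ∂P := by
    intro s b hsb hb B hB
    have hb0 : 0 < b := lt_of_le_of_lt s.2.1 hsb
    have h1 : ∫ ω in B, (cmPath (ζ ω) b - cmPath (ζ ω) s) ∂P =
        ∫ ω in B, (∫ u in Set.Ioc s b, N u ω) ∂P := by
      refine integral_congr_ae (ae_restrict_of_ae ?_)
      filter_upwards [h] with ω hω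
      rw [hω.2, hω.2, ← Set.Iic_union_Ioc_eq_Iic hsb.le, setIntegral_union
        (Set.Iic_disjoint_Ioc le_rfl) measurableSet_Ioc hω.1.integrableOn hω.1.integrableOn,
        add_sub_cancel_left]
    have hmeas : AEStronglyMeasurable (fun p : Ω × I => N p.2 p.1)
        ((P.restrict B).prod (volume.restrict (Set.Ioc s b))) := by
      refine aestronglyMeasurable_of_tendsto_ae atTop
        (f := fun n (p : Ω × I) => N (gridCeil b n p.2) p.1) (fun n => ?_) ?_
      · exact (measurable_uncurry_gridCeil b n fun t ht =>
          ((hNm t (ht.trans_lt hb)).mono (𝓕.le t)).measurable).aestronglyMeasurable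
      · filter_upwards [Measure.quasiMeasurePreserving_snd.ae (ae_restrict_mem measurableSet_Ioc)]
          with p hp
        exact (hr p.1 p.2 (hp.2.trans_lt hb)).tendsto.comp (tendsto_gridCeil hb0 hp.2)
    have hint : Integrable (fun p : Ω × I => N p.2 p.1)
        ((P.restrict B).prod (volume.restrict (Set.Ioc s b))) := by
      refine (integrable_prod_iff' hmeas).2 ⟨?_, ?_⟩
      · filter_upwards [ae_restrict_mem measurableSet_Ioc] with u hu
        exact (hNi u (hu.2.trans_lt hb)).integrableOn
      · refine Integrable.of_bound hmeas.norm.prod_swap.integral_prod_right' (∫ ω, ‖N b ω‖ ∂P) ?_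
        filter_upwards [ae_restrict_mem measurableSet_Ioc] with u hu
        rw [Real.norm_of_nonneg (integral_nonneg fun _ => norm_nonneg _)]
        refine (setIntegral_le_integral (hNi u (hu.2.trans_lt hb)).norm
          (.of_forall fun _ => norm_nonneg _)).trans ?_
        exact (integral_congr_ae ((hNc u b hu.2 hb).fun_comp norm)).symm.trans_le
          (integral_norm_condExp_le _)
    rw [h1, integral_integral_swap hint]
    have h2 : ∀ u ∈ Set.Ioc s b, ∫ ω in B, N u ω ∂P = ∫ ω in B, N s ω ∂P := fun u hu => by
      have hu1 := hu.2.trans_lt hb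
      rw [← setIntegral_condExp (𝓕.le s) (hNi u hu1) hB]
      exact integral_congr_ae (ae_restrict_of_ae (hNc s u hu.1.le hu1))
    rw [setIntegral_congr_fun measurableSet_Ioc h2, setIntegral_const, volume_real_Ioc hsb.le]
  have hle : ∀ s b : I, s ≤ b → s < 1 → ∀ B, MeasurableSet[𝓕 s] B →
      ∫ ω in B, (cmPath (ζ ω) b - cmPath (ζ ω) s) ∂P = (b - s : ℝ) • ∫ ω in B, N s ω ∂P := by
    intro s b hsb hs1 B hB
    have hcl : IsClosed {b : I | ∫ ω in B, (cmPath (ζ ω) b - cmPath (ζ ω) s) ∂P =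
        (b - s : ℝ) • ∫ ω in B, N s ω ∂P} := by
      have hsub : ∀ b, ∫ ω in B, (cmPath (ζ ω) b - cmPath (ζ ω) s) ∂P =
          (∫ ω in B, cmPath (ζ ω) b ∂P) - ∫ ω in B, cmPath (ζ ω) s ∂P := fun b =>
        integral_sub (integrable_cmPath hζ b).integrableOn (integrable_cmPath hζ s).integrableOn
      simp_rw [hsub]
      exact isClosed_eq ((continuous_setIntegral_cmPath hζ B).sub continuous_const)
        ((continuous_subtype_val.sub continuous_const).smul continuous_const)
    have h1 := closure_minimal (fun b (hb : b ∈ Set.Ioo s 1) => hlt s b hb.1 hb.2 B hB) hcl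
    rw [closure_Ioo hs1.ne] at h1
    exact h1 ⟨hsb, b.2.2⟩
  intro s b hsb B hB
  rcases (show s ≤ 1 from s.2.2).eq_or_lt with rfl | hs1
  · simp
  · rw [hle s b hsb hs1 B hB, hle s 1 s.2.2 hs1 B hB, smul_comm]
    rfl

/-- The Riemann sums of the mean velocity `N` converge to the path in mean square: the errors over
the cells of the grid are martingale increments, so that their squares add up. -/
lemma integral_norm_sq_sub_sum_le {ζ : Ω → CameronMartin d} (hζ : MemLp ζ 2 P)
    (hadapted : ∀ t, Measurable[𝓕 t] fun ω => cmPath (ζ ω) t) {N : I → Ω → Euc d}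
    (hNm : ∀ t < 1, StronglyMeasurable[𝓕 t] (N t)) (hN2 : ∀ t < 1, MemLp (N t) 2 P)
    (hN : ∀ s b : I, s < 1 → s ≤ b → ∀ B, MeasurableSet[𝓕 s] B →
      ∫ ω in B, (cmPath (ζ ω) b - cmPath (ζ ω) s) ∂P = (b - s : ℝ) • ∫ ω in B, N s ω ∂P)
    {T : I} (hT : T < 1) {n : ℕ} (hn : 0 < n) :
    ∫ ω, ‖cmPath (ζ ω) T - ∑ i ∈ Finset.range n, (T / n : ℝ) • N (gridPoint T n i) ω‖ ^ 2 ∂P ≤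
      (∫ ω, ‖ζ ω‖ ^ 2 ∂P) / n := by
  have ht1 : ∀ i, gridPoint T n i < 1 := fun i => (gridPoint_le T n i).trans_lt hT
  set Δ : ℕ → Ω → Euc d := fun i ω => gridIncrement T n i (ζ ω)
  set V : ℕ → Ω → Euc d := fun i ω => (T / n : ℝ) • N (gridPoint T n i) ω
  set D : ℕ → Ω → Euc d := fun i ω => Δ i ω - V i ω
  have hΔ2 : ∀ i, MemLp (Δ i) 2 P := fun i => (memLp_cmPath hζ _).sub (memLp_cmPath hζ _)
  have hV2 : ∀ i, MemLp (V i) 2 P := fun i => (hN2 _ (ht1 i)).const_smul (T / n : ℝ)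
  have hD2 : ∀ i, MemLp (D i) 2 P := fun i => (hΔ2 i).sub (hV2 i)
  have hVm : ∀ i, StronglyMeasurable[𝓕 (gridPoint T n i)] (V i) := fun i =>
    (hNm _ (ht1 i)).const_smul (T / n : ℝ)
  have hDm : ∀ i, StronglyMeasurable[𝓕 (gridPoint T n (i + 1))] (D i) := fun i => by
    have hle := 𝓕.mono (gridPoint_mono T n (Nat.le_succ i))
    exact ((hadapted _).sub ((hadapted _).mono hle le_rfl)).stronglyMeasurable.sub ((hVm i).mono hle)
  have hD0 : ∀ i < n, ∀ B, MeasurableSet[𝓕 (gridPoint T n i)] B → ∫ ω in B, D i ω ∂P = 0 := by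
    intro i hi B hB
    have h1 := hN _ _ (ht1 i) (gridPoint_mono T n (Nat.le_succ i)) B hB
    rw [Nat.succ_eq_add_one, gridPoint_succ_sub T hi, ← integral_smul] at h1
    rw [integral_sub ((hΔ2 i).integrable (by norm_num)).integrableOn
      ((hV2 i).integrable (by norm_num)).integrableOn, sub_eq_zero]
    exact h1
  -- Pythagoras' identity for a vector measurable at time `t_i` and the error over the `i`-th cell.
  have hpyth : ∀ i < n, ∀ F : Ω → Euc d, MemLp F 2 P →
      StronglyMeasurable[𝓕 (gridPoint T n i)] F →
      ∫ ω, ‖F ω + D i ω‖ ^ 2 ∂P = (∫ ω, ‖F ω‖ ^ 2 ∂P) + ∫ ω, ‖D i ω‖ ^ 2 ∂P := by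
    intro i hi F hF2 hFm
    have h0 := integral_inner_eq_zero_of_setIntegral_eq_zero (𝓕.le _) hF2 hFm (hD2 i) (hD0 i hi)
    have hF := (memLp_two_iff_integrable_sq_norm hF2.1).1 hF2
    have hD := (memLp_two_iff_integrable_sq_norm (hD2 i).1).1 (hD2 i)
    have hFD := integrable_inner_of_memLp_two hF2 (hD2 i)
    have hsum : Integrable (fun ω => ‖F ω‖ ^ 2 + 2 * (inner ℝ (F ω) (D i ω) : ℝ)) P :=
      hF.add (hFD.const_mul 2)
    simp_rw [norm_add_sq_real]
    rw [integral_add hsum hD, integral_add hF (hFD.const_mul 2),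
      integral_const_mul, h0, mul_zero, add_zero]
  have hDle : ∀ i < n, ∫ ω, ‖D i ω‖ ^ 2 ∂P ≤ ∫ ω, ‖Δ i ω‖ ^ 2 ∂P := by
    intro i hi
    have h1 := hpyth i hi (V i) (hV2 i) (hVm i)
    have h2 : ∀ ω, V i ω + D i ω = Δ i ω := fun ω => add_sub_cancel _ _
    simp_rw [h2] at h1
    have h3 : 0 ≤ ∫ ω, ‖V i ω‖ ^ 2 ∂P := integral_nonneg fun _ => by positivity
    linarith
  have hS2 : ∀ k, MemLp (fun ω => ∑ i ∈ Finset.range k, D i ω) 2 P := fun k =>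
    memLp_finsetSum _ fun i _ => hD2 i
  have hSm : ∀ k, StronglyMeasurable[𝓕 (gridPoint T n k)] fun ω => ∑ i ∈ Finset.range k, D i ω :=
    fun k => Finset.stronglyMeasurable_fun_sum _ fun i hi =>
      (hDm i).mono (𝓕.mono (gridPoint_mono T n (Finset.mem_range.1 hi)))
  have hind : ∀ k ≤ n, ∫ ω, ‖∑ i ∈ Finset.range k, D i ω‖ ^ 2 ∂P ≤
      ∑ i ∈ Finset.range k, ∫ ω, ‖Δ i ω‖ ^ 2 ∂P := by
    intro k
    induction k with
    | zero => simp
    | succ k ih =>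
      intro hk
      simp_rw [Finset.sum_range_succ]
      rw [hpyth k hk _ (hS2 k) (hSm k)]
      exact add_le_add (ih (by omega)) (hDle k hk)
  have hsum : ∀ ω, ∑ i ∈ Finset.range n, D i ω =
      cmPath (ζ ω) T - ∑ i ∈ Finset.range n, (T / n : ℝ) • N (gridPoint T n i) ω := fun ω => by
    have h0 : ∑ i ∈ Finset.range n, Δ i ω = cmPath (ζ ω) T := by
      simp only [Δ, gridIncrement]
      rw [Finset.sum_range_sub (fun i => cmPath (ζ ω) (gridPoint T n i)), gridPoint_zero,
        gridPoint_self T hn, cmPath_zero, sub_zero]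
    rw [← h0, ← Finset.sum_sub_distrib]
  have h1 := hind n le_rfl
  simp_rw [hsum] at h1
  refine h1.trans ?_
  have hΔi : ∀ i, Integrable (fun ω => ‖Δ i ω‖ ^ 2) P := fun i =>
    (memLp_two_iff_integrable_sq_norm (hΔ2 i).1).1 (hΔ2 i)
  have hn' : (0 : ℝ) < n := by exact_mod_cast hn
  rw [← integral_finsetSum _ fun i _ => hΔi i, le_div_iff₀ hn', mul_comm, ← integral_const_mul]
  exact integral_mono ((integrable_finsetSum _ fun i _ => hΔi i).const_mul _)
    ((memLp_two_iff_integrable_sq_norm hζ.1).1 hζ) fun ω => mul_sum_gridIncrement_sq_le T (ζ ω)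

/-- An adapted process with affine mean increments has a density which is a càdlàg martingale, the
mean velocity `N_t = 𝔼[Z_1 - Z_t | 𝓕_t] / (1 - t)`. -/
theorem HasAffineIncrements.exists_martingale {ζ : Ω → CameronMartin d}
    (hA : HasAffineIncrements 𝓕 P ζ) (hζ : MemLp ζ 2 P)
    (hadapted : ∀ t, Measurable[𝓕 t] fun ω => cmPath (ζ ω) t)
    [𝓕.IsRightContinuous] (hcomp : ∀ A, P A = 0 → MeasurableSet[𝓕 0] A) :
    ∃ N : I → Ω → Euc d, Martingale (fun t : Set.Iio (1 : I) => N t) (beforeOne 𝓕) P ∧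
      (∀ ω, ∀ t < (1 : I), ContinuousWithinAt (fun s => N s ω) (Set.Ici t) t) ∧
      (∀ ω, ∀ t < (1 : I), ∃ l, Tendsto (fun s => N s ω) (𝓝[<] t) (𝓝 l)) ∧
      ∀ᵐ ω ∂P, (ζ ω : I → Euc d) =ᵐ[volume] fun s => N s ω := by
  obtain ⟨Y, hYm, hYX, hYr, hYl⟩ := (martingale_condExp (fun ω => cmPath (ζ ω) 1) 𝓕
    P).exists_cadlag_modification_euclidean hcomp
  set N : I → Ω → Euc d := fun t ω => (1 - t : ℝ)⁻¹ • (Y t ω - cmPath (ζ ω) t)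
  have hpos : ∀ t : I, t < 1 → (0 : ℝ) < 1 - t := fun t ht => sub_pos.2 ht
  have hNm : ∀ t < 1, StronglyMeasurable[𝓕 t] (N t) := fun t ht =>
    ((hYm t ht).sub (hadapted t).stronglyMeasurable).const_smul (1 - t : ℝ)⁻¹
  have hN2 : ∀ t < 1, MemLp (N t) 2 P := fun t ht =>
    (((memLp_congr_ae (hYX t ht)).2 ((memLp_cmPath hζ 1).condExp (by norm_num))).sub
      (memLp_cmPath hζ t)).const_smul (1 - t : ℝ)⁻¹
  have hNi : ∀ t < 1, Integrable (N t) P := fun t ht => (hN2 t ht).integrable (by norm_num)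
  have hN1 : ∀ t < 1, ∀ B, MeasurableSet[𝓕 t] B →
      ∫ ω in B, (cmPath (ζ ω) 1 - cmPath (ζ ω) t) ∂P = (1 - t : ℝ) • ∫ ω in B, N t ω ∂P := by
    intro t ht B hB
    have hYi : Integrable (Y t) P := (integrable_congr (hYX t ht)).2 integrable_condExp
    rw [integral_smul, smul_smul, mul_inv_cancel₀ (hpos t ht).ne', one_smul,
      integral_sub hYi.integrableOn (integrable_cmPath hζ t).integrableOn,
      integral_sub (integrable_cmPath hζ 1).integrableOn (integrable_cmPath hζ t).integrableOn,
      integral_congr_ae (ae_restrict_of_ae (hYX t ht)),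
      setIntegral_condExp (𝓕.le t) (integrable_cmPath hζ 1) hB]
  have hNb : ∀ s b : I, s < 1 → s ≤ b → ∀ B, MeasurableSet[𝓕 s] B →
      ∫ ω in B, (cmPath (ζ ω) b - cmPath (ζ ω) s) ∂P = (b - s : ℝ) • ∫ ω in B, N s ω ∂P := by
    intro s b hs hsb B hB
    have h1 := hA s b hsb B hB
    rw [hN1 s hs B hB, smul_comm] at h1
    exact smul_right_injective _ (hpos s hs).ne' h1
  have hinv : ∀ t < (1 : I), ContinuousAt (fun s : I => (1 - s : ℝ)⁻¹) t := fun t ht =>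
    (continuous_const.sub continuous_subtype_val).continuousAt.inv₀ (hpos t ht).ne'
  have hNr : ∀ ω, ∀ t < (1 : I), ContinuousWithinAt (fun s => N s ω) (Set.Ici t) t := fun ω t ht =>
    (hinv t ht).continuousWithinAt.smul
      ((hYr ω t ht).sub (cmPath (ζ ω)).continuous.continuousWithinAt)
  have hNl : ∀ ω, ∀ t < (1 : I), ∃ l, Tendsto (fun s => N s ω) (𝓝[<] t) (𝓝 l) := by
    intro ω t ht
    obtain ⟨l, hl⟩ := hYl ω t
    exact ⟨(1 - t : ℝ)⁻¹ • (l - cmPath (ζ ω) t),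
      ((hinv t ht).tendsto.mono_left nhdsWithin_le_nhds).smul
        (hl.sub (((cmPath (ζ ω)).continuous.tendsto t).mono_left nhdsWithin_le_nhds))⟩
  refine ⟨N, ⟨fun t => hNm t t.2, fun s t hst => ?_⟩, hNr, hNl, ?_⟩
  · refine (ae_eq_condExp_of_forall_setIntegral_eq (𝓕.le s) (hNi t t.2)
      (fun _ _ _ => (hNi s s.2).integrableOn) (fun B hB _ => ?_)
      (hNm s s.2).aestronglyMeasurable).symm
    have h1 := hN1 s s.2 B hB
    have h2 := hN1 t t.2 B (𝓕.mono hst B hB)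
    have h3 := hNb s t s.2 hst B hB
    have h4 : ∫ ω in B, (cmPath (ζ ω) 1 - cmPath (ζ ω) (s : I)) ∂P =
        (∫ ω in B, (cmPath (ζ ω) 1 - cmPath (ζ ω) (t : I)) ∂P) +
          ∫ ω in B, (cmPath (ζ ω) t - cmPath (ζ ω) (s : I)) ∂P := by
      rw [← integral_add (integrable_cmPath_sub hζ _ _).integrableOn
        (integrable_cmPath_sub hζ _ _).integrableOn]
      simp
    rw [h1, h2, h3] at h4
    refine smul_right_injective _ (hpos t t.2).ne' ?_
    simp only
    rw [← sub_eq_iff_eq_add, ← sub_smul] at h4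
    rw [← h4]
    congr 1
    ring
  · obtain ⟨D, hDc, hD⟩ := TopologicalSpace.exists_countable_dense I
    have hT : ∀ T : I, 0 < T → T < 1 →
        ∀ᵐ ω ∂P, cmPath (ζ ω) T = ∫ s in Set.Ioc 0 T, N s ω := by
      intro T hT0 hT1
      set R : ℕ → Ω → Euc d := fun n ω =>
        ∑ i ∈ Finset.range n, (T / n : ℝ) • N (gridPoint T n i) ω
      have hR2 : ∀ n, MemLp (R n) 2 P := fun n => memLp_finsetSum _ fun i _ =>
        (hN2 _ ((gridPoint_le T n i).trans_lt hT1)).const_smul (T / n : ℝ)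
      have hlim : Tendsto (fun n => eLpNorm (R n - fun ω => cmPath (ζ ω) T) 2 P) atTop (𝓝 0) := by
        have h1 : Tendsto (fun n : ℕ => ENNReal.ofReal (((∫ ω, ‖ζ ω‖ ^ 2 ∂P) / n) ^ (2⁻¹ : ℝ)))
            atTop (𝓝 0) := by
          have h2 := (tendsto_const_div_atTop_nhds_zero_nat (∫ ω, ‖ζ ω‖ ^ 2 ∂P)).rpow_const
            (p := (2⁻¹ : ℝ)) (Or.inr (by norm_num))
          rw [Real.zero_rpow (by norm_num)] at h2
          simpa using ENNReal.tendsto_ofReal h2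
        refine tendsto_of_tendsto_of_tendsto_of_le_of_le' tendsto_const_nhds h1
          (.of_forall fun _ => zero_le) ?_
        filter_upwards [eventually_gt_atTop 0] with n hn
        rw [((hR2 n).sub (memLp_cmPath hζ T)).eLpNorm_eq_integral_rpow_norm (by norm_num)
          (by norm_num)]
        refine ENNReal.ofReal_le_ofReal ?_
        simp only [ENNReal.toReal_ofNat, Real.rpow_two, Pi.sub_apply]
        refine Real.rpow_le_rpow (integral_nonneg fun _ => by positivity) ?_ (by norm_num)
        simp_rw [norm_sub_rev (R n _)]
        exact integral_norm_sq_sub_sum_le hζ hadapted hNm hN2 hNb hT1 hn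
      have hmeas := tendstoInMeasure_of_tendsto_eLpNorm two_ne_zero (fun n => (hR2 n).1)
        (memLp_cmPath hζ T).1 hlim
      obtain ⟨ns, hns, hae⟩ := hmeas.exists_seq_tendsto_ae
      filter_upwards [hae] with ω hω
      exact tendsto_nhds_unique hω
        ((tendsto_sum_gridPoint (hNr ω) (hNl ω) hT0 hT1).comp hns.tendsto_atTop)
    have hall : ∀ᵐ ω ∂P, ∀ T ∈ D, 0 < T → T < 1 →
        cmPath (ζ ω) T = ∫ s in Set.Ioc 0 T, N s ω := by
      refine (ae_ball_iff hDc).2 fun T _ => ?_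
      by_cases h0 : 0 < T
      · by_cases h1 : T < 1
        · filter_upwards [hT T h0 h1] with ω hω _ _ using hω
        · exact .of_forall fun ω _ h => absurd h h1
      · exact .of_forall fun ω h => absurd h h0
    filter_upwards [hall] with ω hω
    exact ae_eq_of_dense_integral_eq (cm_integrable _) (hNr ω) (hNl ω) hD hω

end MartingaleDensity

/-! ### Adapted maps of the path space -/

section AdaptedMaps

variable {d : ℕ} {η : Measure (PathSpace d)}

lemma completed_apply (A : Set (PathSpace d)) : completed η A = η A :=
  Measure.completion_apply η A

lemma ae_completed_iff {p : PathSpace d → Prop} :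
    (∀ᵐ ω ∂(completed η), p ω) ↔ ∀ᵐ ω ∂η, p ω := by
  rw [ae_iff, ae_iff, completed_apply]

/-- The filtration generated by the evaluation process, before augmentation. -/
abbrev rawField (d : ℕ) (t : I) : MeasurableSpace (PathSpace d) :=
  ⨆ s ≤ t, MeasurableSpace.comap (fun ω => ω s) inferInstance

lemma rawField_sup_nullField_le (t : I) : rawField d t ⊔ nullField η ≤ usualFiltration η t := by
  rw [usualFiltration]
  refine le_trans (le_of_eq ?_) (Filtration.le_rightCont _ t)
  rfl

lemma usualFiltration_le {s t : I} (h : s < t) :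
    usualFiltration η s ≤ rawField d t ⊔ nullField η := by
  rw [usualFiltration, Filtration.rightCont_eq_of_not_isMax _ (not_isMax_iff.2 ⟨t, h⟩)]
  exact iInf₂_le t h

instance : (usualFiltration η).IsRightContinuous := by
  rw [usualFiltration]
  infer_instance

lemma measurableSet_usualFiltration_of_forall_gt {t : I} (ht : t < 1) {A : Set (PathSpace d)}
    (h : ∀ u > t, MeasurableSet[usualFiltration η u] A) : MeasurableSet[usualFiltration η t] A := by
  apply Filtration.IsRightContinuous.measurableSet
  rw [Filtration.rightCont_eq_of_not_isMax _ (not_isMax_iff.2 ⟨1, ht⟩)]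
  simp only [MeasurableSpace.measurableSet_iInf]
  exact h

lemma measurableSet_usualFiltration_of_null {A : Set (PathSpace d)} (hA : η A = 0) (t : I) :
    MeasurableSet[usualFiltration η t] A :=
  rawField_sup_nullField_le t _ (le_sup_right (a := rawField d t) _
    (MeasurableSpace.measurableSet_generateFrom hA))

lemma measurable_eval_usualFiltration (t : I) :
    Measurable[usualFiltration η t] fun ω : PathSpace d => ω t :=
  (comap_measurable _).mono ((le_iSup₂ (f := fun s (_ : s ≤ t) =>
    MeasurableSpace.comap (fun ω : PathSpace d => ω s) inferInstance) t le_rfl).trans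
      (le_sup_left.trans (rawField_sup_nullField_le t))) le_rfl

/-- A set of the past up to time `t` contains, with a path, every path with the same past. -/
lemma mem_iff_of_measurableSet_rawField {t : I} {A : Set (PathSpace d)}
    (hA : MeasurableSet[rawField d t] A) {y y' : PathSpace d} (h : ∀ s ≤ t, y s = y' s) :
    y ∈ A ↔ y' ∈ A := by
  have h1 : rawField d t ≤ MeasurableSpace.comap (fun ω (s : Set.Iic t) => ω (s : I)) inferInstance :=
    iSup₂_le fun s hs => by
      rintro _ ⟨C, hC, rfl⟩
      exact ⟨(fun z => z ⟨s, hs⟩) ⁻¹' C, measurable_pi_apply _ hC, rfl⟩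
  obtain ⟨C, -, rfl⟩ := h1 A hA
  have h2 : (fun s : Set.Iic t => y s) = fun s : Set.Iic t => y' s := funext fun s => h s s.2
  simp only [Set.mem_preimage, h2]

lemma exists_ae_eq_of_measurableSet_sup_nullField {𝓖 : MeasurableSpace (PathSpace d)}
    {A : Set (PathSpace d)} (hA : MeasurableSet[𝓖 ⊔ nullField η] A) :
    ∃ A', MeasurableSet[𝓖] A' ∧ ∀ᵐ ω ∂η, ω ∈ A ↔ ω ∈ A' := by
  have h : 𝓖 ⊔ nullField η ≤ eventuallyMeasurableSpace 𝓖 (ae η) :=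
    sup_le le_eventuallyMeasurableSpace (MeasurableSpace.generateFrom_le fun B hB =>
      ⟨∅, @MeasurableSet.empty _ 𝓖, ae_eq_empty.2 hB⟩)
  obtain ⟨A', hA', h'⟩ := h A hA
  exact ⟨A', hA', h'.mem_iff⟩

section Push

variable {T : PathSpace d → PathSpace d}

lemma preimage_null_of_push_null (hT : @Measurable _ _ (completedBorel η) inferInstance T)
    {A : Set (PathSpace d)} (hA : push η T A = 0) : η (T ⁻¹' A) = 0 := by
  rw [← completed_apply]
  exact @Measure.preimage_null_of_map_null _ _ (completedBorel η) _ (completed η) T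
    (@Measurable.aemeasurable _ _ (completedBorel η) _ _ (completed η) hT) A hA

lemma ae_of_ae_push (hT : @Measurable _ _ (completedBorel η) inferInstance T)
    {p : PathSpace d → Prop} (h : ∀ᵐ y ∂(push η T), p y) : ∀ᵐ ω ∂η, p (T ω) :=
  preimage_null_of_push_null hT h

lemma push_apply (hT : @Measurable _ _ (completedBorel η) inferInstance T) {A : Set (PathSpace d)}
    (hA : NullMeasurableSet A (push η T)) : push η T A = η (T ⁻¹' A) := by
  rw [← completed_apply]
  exact @Measure.map_apply₀ _ _ (completedBorel η) _ (completed η) T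
    (@Measurable.aemeasurable _ _ (completedBorel η) _ _ (completed η) hT) A hA

lemma ae_push_of_ae (hT : @Measurable _ _ (completedBorel η) inferInstance T)
    {p : PathSpace d → Prop} (hp : NullMeasurableSet {y | p y} (push η T))
    (h : ∀ᵐ ω ∂η, p (T ω)) : ∀ᵐ y ∂(push η T), p y := by
  rw [ae_iff, ← Set.compl_ofPred, push_apply hT hp.compl]
  exact h

lemma push_congr {T' : PathSpace d → PathSpace d} (h : ∀ᵐ ω ∂η, T ω = T' ω) :
    push η T = push η T' :=
  @Measure.map_congr _ _ (completedBorel η) _ (completed η) T T' (ae_completed_iff.2 h)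

lemma push_id : push η (fun ω => ω) = η := by
  ext A hA
  exact push_apply (fun _ h => borel_le_completedBorel η _ h)
    (MeasurableSet.nullMeasurableSet hA)

lemma measurable_completedBorel_push (hT : @Measurable _ _ (completedBorel η) inferInstance T) :
    @Measurable _ _ (completedBorel η) (completedBorel (push η T)) T := by
  intro A hA
  obtain ⟨B, -, hB, hBA⟩ := NullMeasurableSet.exists_measurable_superset_ae_eq hA
  have h1 : T ⁻¹' B =ᵐ[η] T ⁻¹' A :=
    (ae_of_ae_push hT hBA.mem_iff).mono fun ω hω => propext hω
  exact NullMeasurableSet.congr (hT hB) h1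

lemma push_comp {V : PathSpace d → PathSpace d}
    (hT : @Measurable _ _ (completedBorel η) inferInstance T)
    (hV : @Measurable _ _ (completedBorel (push η T)) inferInstance V) :
    push (push η T) V = push η fun ω => V (T ω) := by
  have hVT : @Measurable _ _ (completedBorel η) inferInstance fun ω => V (T ω) :=
    @Measurable.comp _ _ _ (completedBorel η) (completedBorel (push η T)) _ V T hV
      (measurable_completedBorel_push hT)
  ext A hA
  rw [push_apply hV (MeasurableSet.nullMeasurableSet hA), push_apply hT (hV hA),
    push_apply hVT (MeasurableSet.nullMeasurableSet hA)]
  rfl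

/-- An adapted map pulls the augmented filtration of its law back into the augmented filtration. -/
lemma PathVariation.IsAdaptedMap.measurable_usualFiltration (hT : IsAdaptedMap η T) (t : I) :
    Measurable[usualFiltration η t, usualFiltration (push η T) t] T := by
  have hraw : ∀ u, Measurable[usualFiltration η u, rawField d u ⊔ nullField (push η T)] T := by
    intro u
    rw [measurable_iff_comap_le, MeasurableSpace.comap_le_iff_le_map]
    refine sup_le (iSup₂_le fun s hs => ?_) (MeasurableSpace.generateFrom_le fun A hA => ?_)
    · rintro _ ⟨C, hC, rfl⟩
      exact (usualFiltration η).mono hs _ (hT.adapted s hC)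
    · exact measurableSet_usualFiltration_of_null (preimage_null_of_push_null hT.measurable hA) u
  intro A hA
  rcases (show t ≤ 1 from t.2.2).eq_or_lt with rfl | ht
  · have hmax : IsMax (1 : I) := fun u _ => u.2.2
    rw [usualFiltration, Filtration.rightCont_eq_of_isMax _ hmax] at hA
    exact hraw 1 hA
  · exact measurableSet_usualFiltration_of_forall_gt ht fun u hu => hraw u (usualFiltration_le hu _ hA)

lemma PathVariation.IsAdaptedMap.comp {V : PathSpace d → PathSpace d} (hT : IsAdaptedMap η T)
    (hV : IsAdaptedMap (push η T) V) : IsAdaptedMap η fun ω => V (T ω) where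
  measurable := fun _ hA => measurable_completedBorel_push hT.measurable (hV.measurable hA)
  adapted t := fun _ hC => hT.measurable_usualFiltration t (hV.adapted t hC)

end Push

end AdaptedMaps

/-! ### Elementary variations -/

section Elementary

variable {d : ℕ}

lemma indicator_const_apply {Ω : Type*} (A : Set Ω) (κ : PathSpace d) (t : I) (ω : Ω) :
    (A.indicator (fun _ => κ) ω) t = A.indicator (fun _ => κ t) ω := by
  by_cases h : ω ∈ A <;> simp [h]

lemma measurable_add_indicator_const {Ω : Type*} {m : MeasurableSpace Ω} {U : Ω → PathSpace d}
    (hU : Measurable U) {B : Set Ω} (hB : MeasurableSet B) (κ : PathSpace d) :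
    Measurable fun ω => U ω + B.indicator (fun _ => κ) ω :=
  hU.add (measurable_const.indicator hB)

lemma isAdaptedMap_id (η : Measure (PathSpace d)) : IsAdaptedMap η fun ω => ω :=
  ⟨fun _ h => borel_le_completedBorel η _ h, measurable_eval_usualFiltration⟩

lemma PathVariation.IsAdaptedMap.add_indicator {η : Measure (PathSpace d)}
    {U : PathSpace d → PathSpace d} (hU : IsAdaptedMap η U) {a : I} {B : Set (PathSpace d)}
    (hB : MeasurableSet[usualFiltration η a] B) {κ : PathSpace d} (hκ : ∀ t ≤ a, κ t = 0) :
    IsAdaptedMap η fun ω => U ω + B.indicator (fun _ => κ) ω := by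
  refine ⟨measurable_add_indicator_const hU.measurable ((usualFiltration η).le a B hB) κ,
    fun t => ?_⟩
  simp only [ContinuousMap.add_apply, indicator_const_apply]
  rcases le_or_gt t a with ht | ht
  · simp only [hκ t ht, Set.indicator_zero, add_zero]
    exact hU.adapted t
  · exact (hU.adapted t).add (measurable_const.indicator ((usualFiltration η).mono ht.le B hB))

/-- Adding to an isomorphism of filtered probability spaces `U` a deterministic path `κ` on an event
`B` of the past up to time `s` gives an isomorphism if `κ` vanishes up to some time `a > s`: the
perturbed path agrees with `U` up to time `a`, hence determines `B`, and `κ` can be subtracted. -/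
theorem PathVariation.IsFilteredIso.add_indicator {η : Measure (PathSpace d)}
    {U : PathSpace d → PathSpace d} (hU : IsFilteredIso η U) {s a : I} (hsa : s < a)
    {B : Set (PathSpace d)} (hB : MeasurableSet[usualFiltration η s] B) {κ : PathSpace d}
    (hκ : ∀ t ≤ a, κ t = 0) : IsFilteredIso η fun ω => U ω + B.indicator (fun _ => κ) ω := by
  obtain ⟨hUa, V, hV, hVU, -⟩ := hU
  rw [ae_completed_iff] at hVU
  have hVpush : push (push η U) V = η := by
    rw [push_comp hUa.measurable hV.measurable, push_congr hVU, push_id]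
  set U' : PathSpace d → PathSpace d := fun ω => U ω + B.indicator (fun _ => κ) ω with hU'
  have hU'a : IsAdaptedMap η U' := hUa.add_indicator ((usualFiltration η).mono hsa.le B hB) hκ
  -- The event `B`, seen from the path `U`, is decided by the path `U` up to time `a`.
  obtain ⟨B', hB', hBB'⟩ : ∃ B', MeasurableSet[rawField d a] B' ∧
      ∀ᵐ y ∂(push η U), y ∈ V ⁻¹' B ↔ y ∈ B' := by
    refine exists_ae_eq_of_measurableSet_sup_nullField (usualFiltration_le hsa _ ?_)
    have h1 := hV.measurable_usualFiltration s
    rw [hVpush] at h1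
    exact h1 hB
  set T : PathSpace d → PathSpace d := fun y => y + B'.indicator (fun _ => -κ) y with hT
  have hTU : ∀ᵐ ω ∂η, T (U' ω) = U ω := by
    filter_upwards [hVU, ae_of_ae_push hUa.measurable hBB'] with ω h1 h2
    have h3 : U' ω ∈ B' ↔ ω ∈ B := by
      rw [← mem_iff_of_measurableSet_rawField hB' (y := U ω)
        fun t ht => by simp [hU', indicator_const_apply, hκ t ht], ← h2, Set.mem_preimage, h1]
    simp only [hT]
    by_cases h : ω ∈ B
    · rw [Set.indicator_of_mem (h3.2 h)]
      simp [hU', h]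
    · rw [Set.indicator_of_notMem fun h' => h (h3.1 h')]
      simp [hU', h]
  have hTa : IsAdaptedMap (push η U') T :=
    (isAdaptedMap_id _).add_indicator
      (rawField_sup_nullField_le a _ (le_sup_left (b := nullField (push η U')) _ hB'))
      fun t ht => by simp [hκ t ht]
  have hTpush : push (push η U') T = push η U := by
    rw [push_comp hU'a.measurable hTa.measurable, push_congr hTU]
  have hVa : IsAdaptedMap (push (push η U') T) V := by rwa [hTpush]
  have hVT := hTa.comp hVa
  have hVTpush : push (push η U') (fun y => V (T y)) = η := by
    rw [← push_comp hTa.measurable hVa.measurable, hTpush, hVpush]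
  have hinv : ∀ᵐ ω ∂η, V (T (U' ω)) = ω := by
    filter_upwards [hTU, hVU] with ω h1 h2
    rw [h1, h2]
  refine ⟨hU'a, fun y => V (T y), hVT, ae_completed_iff.2 hinv, ae_completed_iff.2 ?_⟩
  have hU'VT : IsAdaptedMap (push η U') fun y => U' (V (T y)) :=
    hVT.comp (by rwa [hVTpush])
  refine ae_push_of_ae hU'a.measurable ?_ ?_
  · exact @measurableSet_eq_fun _ _ (completedBorel (push η U')) _ _ _ _ hU'VT.measurable
      (isAdaptedMap_id _).measurable
  · filter_upwards [hinv] with ω hω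
    rw [hω]

lemma cmPath_indicator {Ω : Type*} (B : Set Ω) (κ : CameronMartin d) (ω : Ω) :
    cmPath (B.indicator (fun _ => κ) ω) = B.indicator (fun _ => cmPath κ) ω := by
  by_cases h : ω ∈ B
  · simp [h]
  · simp only [h, not_false_eq_true, Set.indicator_of_notMem]
    ext1 t
    exact map_zero (cmEval t)

lemma isBoundedVariationZero_indicator {ν : Measure (PathSpace d)} [IsProbabilityMeasure ν]
    {s a : I} (hsa : s < a) {B : Set (PathSpace d)} (hB : MeasurableSet[usualFiltration ν s] B)
    {κ : CameronMartin d} (hκ : ∀ t ≤ a, cmPath κ t = 0) (hκ1 : cmPath κ 1 = 0) :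
    IsBoundedVariationZero ν (B.indicator fun _ => κ) := by
  have hfin : IsFiniteMeasure (completed ν) := ⟨by rw [completed_apply]; exact measure_lt_top ν _⟩
  have hzero : ∀ (A : Set (PathSpace d)) ω t, cmPath κ t = 0 →
      cmPath (A.indicator (fun _ => κ) ω) t = 0 := fun A ω t ht => by
    rw [cmPath_indicator]
    by_cases h : ω ∈ A <;> simp [h, ht]
  refine ⟨⟨⟨(memLp_const κ).indicator ((usualFiltration ν).le s _ hB), fun t => ?_⟩,
    fun U hU => ⟨?_, ?_⟩⟩, ⟨‖cmPath κ‖ + 1, by positivity, .of_forall fun ω => ?_⟩,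
    .of_forall fun ω => ⟨cmPath_zero _, hzero B ω 1 hκ1⟩⟩
  · rcases le_or_gt t a with ht | ht
    · simp only [hzero B _ t (hκ t ht)]
      exact measurable_const
    · have h1 : (fun ω => cmPath (B.indicator (fun _ => κ) ω) t) =
          B.indicator fun _ => cmPath κ t := funext fun ω => by
        rw [cmPath_indicator]
        by_cases h : ω ∈ B <;> simp [h]
      rw [h1]
      exact measurable_const.indicator ((usualFiltration ν).mono (hsa.trans ht).le _ hB)
  · simp only [cmPath_indicator]
    exact hU.1.add_indicator hsa hB hκ
  · rw [hU.2]
    simp only [initialField, ContinuousMap.add_apply, cmPath_zero, add_zero]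
  · rw [cmPath_indicator]
    by_cases h : ω ∈ B
    · simp [h]
    · simp only [h, not_false_eq_true, Set.indicator_of_notMem, norm_zero]
      positivity

/-- The path of the Cameron-Martin space with velocity `x / (b - a)` on `(a, b]`, velocity
`-x / (e - c)` on `(c, e]`, and velocity `0` elsewhere. -/
noncomputable def bumpPath (a b c e : I) (x : Euc d) : CameronMartin d :=
  (b - a : ℝ)⁻¹ • indicatorConstLp 2 (measurableSet_Ioc (a := a) (b := b)) (measure_ne_top _ _) x -
    (e - c : ℝ)⁻¹ • indicatorConstLp 2 (measurableSet_Ioc (a := c) (b := e)) (measure_ne_top _ _) x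

lemma cmPath_bumpPath (a b c e : I) (x : Euc d) (t : I) :
    cmPath (bumpPath a b c e x) t =
      (b - a : ℝ)⁻¹ • (volume : Measure I).real (Set.Ioc a b ∩ Set.Iic t) • x -
        (e - c : ℝ)⁻¹ • (volume : Measure I).real (Set.Ioc c e ∩ Set.Iic t) • x := by
  rw [← cmEval_apply, bumpPath, map_sub, map_smul, map_smul]
  congr 2 <;> exact setIntegral_indicatorConstLp measurableSet_Iic _ _ _

lemma cmPath_bumpPath_of_le {a b c e : I} (hac : a ≤ c) (x : Euc d) {t : I} (ht : t ≤ a) :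
    cmPath (bumpPath a b c e x) t = 0 := by
  have h : ∀ u v : I, t ≤ u → Set.Ioc u v ∩ Set.Iic t = ∅ := fun u v hu =>
    Set.eq_empty_of_forall_notMem fun r hr => (hr.1.1.trans_le (hr.2.trans hu)).false
  rw [cmPath_bumpPath, h a b ht, h c e (ht.trans hac)]
  simp

lemma cmPath_bumpPath_one {a b c e : I} (hab : a < b) (hce : c < e) (x : Euc d) :
    cmPath (bumpPath a b c e x) 1 = 0 := by
  have h : ∀ u v : I, Set.Ioc u v ∩ Set.Iic 1 = Set.Ioc u v := fun u v =>
    Set.inter_eq_left.2 fun r _ => r.2.2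
  rw [cmPath_bumpPath, h, h, volume_real_Ioc hab.le, volume_real_Ioc hce.le,
    inv_smul_smul₀ (sub_pos.2 (show (a : ℝ) < b from hab)).ne',
    inv_smul_smul₀ (sub_pos.2 (show (c : ℝ) < e from hce)).ne', sub_self]

lemma inner_bumpPath {a b c e : I} (hab : a ≤ b) (hce : c ≤ e) (x : Euc d) (z : CameronMartin d) :
    (inner ℝ (bumpPath a b c e x) z : ℝ) = inner ℝ x
      ((b - a : ℝ)⁻¹ • (cmPath z b - cmPath z a) - (e - c : ℝ)⁻¹ • (cmPath z e - cmPath z c)) := by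
  rw [bumpPath, inner_sub_left, real_inner_smul_left, real_inner_smul_left,
    L2.inner_indicatorConstLp_eq_inner_setIntegral, L2.inner_indicatorConstLp_eq_inner_setIntegral,
    inner_sub_right, real_inner_smul_right, real_inner_smul_right, cmPath_sub_cmPath z hab,
    cmPath_sub_cmPath z hce]

/-- Orthogonality to the elementary variations forces affine mean increments. -/
theorem hasAffineIncrements_of_orthogonal {Ω : Type*} {m : MeasurableSpace Ω} {P : Measure Ω}
    {𝓕 : Filtration I m} [IsProbabilityMeasure P] {ζ : Ω → CameronMartin d} (hζ : MemLp ζ 2 P)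
    (h : ∀ s a : I, s < a → ∀ B, MeasurableSet[𝓕 s] B → ∀ κ : CameronMartin d,
      (∀ t ≤ a, cmPath κ t = 0) → cmPath κ 1 = 0 →
        ∫ ω, (inner ℝ (ζ ω) (B.indicator (fun _ => κ) ω) : ℝ) ∂P = 0) :
    HasAffineIncrements 𝓕 P ζ := by
  refine hasAffineIncrements_of_slope_eq hζ fun s a b c e hsa hab hbc hce B hB => ?_
  have hBm := 𝓕.le s _ hB
  have hI : ∀ (r : ℝ) (u v : I),
      Integrable (fun ω => r • (cmPath (ζ ω) v - cmPath (ζ ω) u)) (P.restrict B) :=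
    fun r u v => (integrable_cmPath_sub hζ u v).integrableOn.smul r
  have hI2 : Integrable (fun ω => (b - a : ℝ)⁻¹ • (cmPath (ζ ω) b - cmPath (ζ ω) a) -
      (e - c : ℝ)⁻¹ • (cmPath (ζ ω) e - cmPath (ζ ω) c)) (P.restrict B) :=
    (hI _ _ _).sub (hI _ _ _)
  rw [← sub_eq_zero]
  refine ext_inner_left ℝ fun x => ?_
  rw [inner_zero_right, ← h s a hsa B hB (bumpPath a b c e x)
    (fun t ht => cmPath_bumpPath_of_le (hab.le.trans hbc) x ht) (cmPath_bumpPath_one hab hce x),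
    ← integral_smul, ← integral_smul, ← integral_sub (hI _ _ _) (hI _ _ _),
    ← integral_inner hI2, ← integral_indicator hBm]
  refine integral_congr_ae (.of_forall fun ω => ?_)
  by_cases hω : ω ∈ B
  · simp only [Set.indicator_of_mem hω]
    rw [← inner_bumpPath hab.le hce.le, real_inner_comm]
  · simp [hω]

end Elementary

/-! ### Orthogonality to centred adapted directions -/

section Centred

variable {d : ℕ}

lemma cmEval_integral_eq_zero {Ω : Type*} {m : MeasurableSpace Ω} {P : Measure Ω}
    {k : Ω → CameronMartin d} (hk : Integrable k P) {t : I}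
    (h : ∀ ω, cmEval t (k ω) = 0) : cmEval t (∫ ω, k ω ∂P) = 0 := by
  rw [← ContinuousLinearMap.integral_comp_comm _ hk]
  simp [h]

variable {Ω : Type*} {m : MeasurableSpace Ω} {P : Measure Ω} [IsProbabilityMeasure P]

/-- Subtracting the mean from `ξ` and subtracting it from `k` have the same effect on the
pairing. -/
lemma integral_inner_sub_integral {H : Type*} [NormedAddCommGroup H] [InnerProductSpace ℝ H]
    [CompleteSpace H] {ξ k : Ω → H} (hξ : MemLp ξ 2 P) (hk : MemLp k 2 P) :
    ∫ ω, (inner ℝ (ξ ω - ∫ x, ξ x ∂P) (k ω) : ℝ) ∂P =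
      ∫ ω, (inner ℝ (ξ ω) (k ω - ∫ x, k x ∂P) : ℝ) ∂P := by
  have hξ1 : Integrable ξ P := hξ.integrable (by norm_num)
  have hk1 : Integrable k P := hk.integrable (by norm_num)
  have h1 : ∫ ω, (inner ℝ (ξ ω) (∫ x, k x ∂P) : ℝ) ∂P = inner ℝ (∫ x, ξ x ∂P) (∫ x, k x ∂P) := by
    simp_rw [real_inner_comm (∫ x, k x ∂P)]
    exact integral_inner hξ1 _
  simp_rw [inner_sub_left, inner_sub_right]
  rw [integral_sub (integrable_inner_of_memLp_two hξ hk) (hk1.const_inner _),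
    integral_sub (integrable_inner_of_memLp_two hξ hk) (hξ1.inner_const _),
    integral_inner hk1, h1]

variable {𝓕 : Filtration I m}

lemma memLp_sub_integral {H : Type*} [NormedAddCommGroup H] [NormedSpace ℝ H] {k : Ω → H}
    (hk : MemLp k 2 P) : MemLp (fun ω => k ω - ∫ x, k x ∂P) 2 P :=
  hk.sub (memLp_const _)

lemma measurable_cmPath_sub_const {k : Ω → CameronMartin d}
    (hk : ∀ t, Measurable[𝓕 t] fun ω => cmPath (k ω) t) (e : CameronMartin d) (t : I) :
    Measurable[𝓕 t] fun ω => cmPath (k ω - e) t := by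
  simp only [← cmEval_apply, map_sub]
  exact (hk t).sub_const _

/-- The constant part of the decomposition is the mean of `ξ`: orthogonality of `ξ` to the
elementary variations minus their means is orthogonality of `ξ` minus its mean to the elementary
variations. -/
theorem exists_martingale_of_orthogonal_centred [𝓕.IsRightContinuous]
    (hcomp : ∀ A, P A = 0 → MeasurableSet[𝓕 0] A) {ξ : Ω → CameronMartin d} (hξ : MemLp ξ 2 P)
    (hadapted : ∀ t, Measurable[𝓕 t] fun ω => cmPath (ξ ω) t)
    (h : ∀ s a : I, s < a → ∀ B, MeasurableSet[𝓕 s] B → ∀ κ : CameronMartin d,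
      (∀ t ≤ a, cmPath κ t = 0) → cmPath κ 1 = 0 →
        ∫ ω, (inner ℝ (ξ ω) (B.indicator (fun _ => κ) ω -
          ∫ x, B.indicator (fun _ => κ) x ∂P) : ℝ) ∂P = 0) :
    ∃ N : I → Ω → Euc d, Martingale (fun t : Set.Iio (1 : I) => N t) (beforeOne 𝓕) P ∧
      (∀ ω, ∀ t < (1 : I), ContinuousWithinAt (fun s => N s ω) (Set.Ici t) t) ∧
      (∀ ω, ∀ t < (1 : I), ∃ l, Tendsto (fun s => N s ω) (𝓝[<] t) (𝓝 l)) ∧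
      ∀ᵐ ω ∂P, Integrable (fun s => N s ω) (volume : Measure I) ∧ ∀ t : I, cmPath (ξ ω) t =
        (∫ s in Set.Iic t, (∫ x, ξ x ∂P : CameronMartin d) s) + ∫ s in Set.Iic t, N s ω := by
  have hA : HasAffineIncrements 𝓕 P fun ω => ξ ω - ∫ x, ξ x ∂P :=
    hasAffineIncrements_of_orthogonal (memLp_sub_integral hξ) fun s a hsa B hB κ hκ hκ1 => by
      rw [integral_inner_sub_integral hξ ((memLp_const κ).indicator (𝓕.le s B hB))]
      exact h s a hsa B hB κ hκ hκ1
  obtain ⟨N, hN, hr, hl, hae⟩ := hA.exists_martingale (memLp_sub_integral hξ)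
    (measurable_cmPath_sub_const hadapted _) hcomp
  refine ⟨N, hN, hr, hl, ?_⟩
  filter_upwards [hae] with ω hω
  refine ⟨(cm_integrable _).congr hω, fun t => ?_⟩
  rw [← integral_congr_ae (ae_restrict_of_ae hω)]
  change _ = cmEval t _ + cmEval t _
  rw [← map_add, add_sub_cancel, cmEval_apply]

/-- The converse: a deterministic velocity pairs to zero with a centred direction, and a martingale
velocity with an adapted direction that vanishes at time `1`. -/
theorem integral_inner_eq_zero_of_martingale {ξ : Ω → CameronMartin d} (hξ : MemLp ξ 2 P)
    {N : I → Ω → Euc d} {A : I → Euc d}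
    (hN : Martingale (fun t : Set.Iio (1 : I) => N t) (beforeOne 𝓕) P)
    (hr : ∀ ω, ∀ t < (1 : I), ContinuousWithinAt (fun s => N s ω) (Set.Ici t) t)
    (hA : MemLp A 2 (volume : Measure I))
    (h : ∀ᵐ ω ∂P, Integrable (fun s => N s ω) (volume : Measure I) ∧
      ∀ t : I, cmPath (ξ ω) t = (∫ s in Set.Iic t, A s) + ∫ s in Set.Iic t, N s ω)
    {k : Ω → CameronMartin d} (hk : MemLp k 2 P)
    (hadapted : ∀ t, Measurable[𝓕 t] fun ω => cmPath (k ω) t)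
    (hk1 : ∀ᵐ ω ∂P, cmPath (k ω) 1 = 0) (hmean : ∫ ω, k ω ∂P = 0) :
    ∫ ω, (inner ℝ (ξ ω) (k ω) : ℝ) ∂P = 0 := by
  have he : MemLp (fun ω => ξ ω - hA.toLp A) 2 P := hξ.sub (memLp_const _)
  have h1 : HasAffineIncrements 𝓕 P fun ω => ξ ω - hA.toLp A := by
    refine hasAffineIncrements_of_martingale he hN hr ?_
    filter_upwards [h] with ω hω
    refine ⟨hω.1, fun t => ?_⟩
    rw [← cmEval_apply, map_sub, cmEval_apply, hω.2, sub_eq_iff_eq_add, add_comm]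
    exact congrArg _ (integral_congr_ae (ae_restrict_of_ae hA.coeFn_toLp.symm))
  have h2 := h1.integral_inner_eq_zero he hk hadapted hk1
  simp_rw [real_inner_comm _ (k _), inner_sub_left] at h2
  rwa [integral_sub (integrable_inner_of_memLp_two hξ hk)
    ((hk.integrable (by norm_num)).const_inner _),
    integral_inner (hk.integrable (by norm_num)), hmean, inner_zero_right, sub_zero] at h2

end Centred

/-! ### The differential on adapted directions vanishing at both ends -/

section Differential

variable {d : ℕ} {ν : Measure (PathSpace d)} [IsProbabilityMeasure ν]

instance : IsProbabilityMeasure (completed ν) := ⟨by rw [completed_apply]; exact measure_univ⟩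

/-- The variations of the class `V^{0,∞}` contain the elementary ones, which decide the differential
on all adapted directions vanishing at both ends: two candidates for the gradient differ by a field
with affine mean increments. -/
theorem PathVariation.differential_eq_pairing {S : SemimartingaleLaws d → ENNReal}
    (hS : IsDifferentiable S ν) {ξ : PathSpace d → CameronMartin d} (hξ : MemLp ξ 2 (completed ν))
    (hgrad : ∀ h, IsBoundedVariationZero ν h → differential S ν h = pairing ν ξ h)
    {h : PathSpace d → CameronMartin d} (hh : IsAdaptedL2 ν h) (h1 : VanishesAtEnds ν h) :
    differential S ν h = pairing ν ξ h := by
  obtain ⟨ξ₀, hξ₀, hdiff⟩ : ∃ ξ₀, MemLp ξ₀ 2 (completed ν) ∧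
      ∀ k, differential S ν k = pairing ν ξ₀ k :=
    ⟨_, hS.2.choose_spec.1.memLp, fun k => by rw [differential, dif_pos hS]⟩
  have hsub : ∀ k, MemLp k 2 (completed ν) →
      ∫ ω, (inner ℝ (ξ₀ ω - ξ ω) (k ω) : ℝ) ∂(completed ν) = pairing ν ξ₀ k - pairing ν ξ k :=
    fun k hk => by
      simp_rw [inner_sub_left]
      exact integral_sub (integrable_inner_of_memLp_two hξ₀ hk)
        (integrable_inner_of_memLp_two hξ hk)
  have hA : HasAffineIncrements (usualFiltration ν) (completed ν) fun ω => ξ₀ ω - ξ ω :=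
    hasAffineIncrements_of_orthogonal (hξ₀.sub hξ) fun s a hsa B hB κ hκ hκ1 => by
      have hk := isBoundedVariationZero_indicator hsa hB hκ hκ1
      rw [hsub _ hk.1.1.memLp, ← hdiff, hgrad _ hk, sub_self]
  have h2 := hA.integral_inner_eq_zero (hξ₀.sub hξ) hh.memLp hh.adapted (h1.mono fun _ h => h.2)
  simp_rw [real_inner_comm _ (h _)] at h2
  rw [hdiff, ← sub_eq_zero, ← hsub h hh.memLp, h2]

end Differential

theorem lemma4p1 (d : ℕ) (S : SemimartingaleLaws d → ENNReal) (ν : Measure (PathSpace d))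
    (hν : ν ∈ SemimartingaleLaws d) (hS : IsDifferentiable S ν)
    (ξ : PathSpace d → CameronMartin d) (hξ : IsAdaptedL2 ν ξ)
    (hgrad : ∀ h, IsBoundedVariationZero ν h → differential S ν h = pairing ν ξ h) :
    (∀ h, IsAdaptedL2 ν h → VanishesAtEnds ν h → ∫ ω, h ω ∂(completed ν) = 0 →
        differential S ν h = 0) ↔
      ∃ (N : I → PathSpace d → Euc d) (A : I → Euc d),
        IsCadlagMartingale ν N ∧ Measurable A ∧ MemLp A 2 (volume : Measure I) ∧
        ∀ᵐ ω ∂(completed ν), Integrable (fun s => N s ω) (volume : Measure I) ∧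
          ∀ t : I, cmPath (ξ ω) t = (∫ s in Set.Iic t, A s) + ∫ s in Set.Iic t, N s ω := by
  have hprob : IsProbabilityMeasure ν := hν.1
  constructor
  · intro h
    -- A centred elementary variation is an admissible direction in the first condition.
    obtain ⟨N, hN, hr, hl, hae⟩ := exists_martingale_of_orthogonal_centred
      (fun A hA => measurableSet_usualFiltration_of_null (by rwa [completed_apply] at hA) 0)
      hξ.memLp hξ.adapted fun s a hsa B hB κ hκ hκ1 => by
        have hk := (isBoundedVariationZero_indicator hsa hB hκ hκ1).1.1
        have hint := hk.memLp.integrable (q := 2) (by norm_num)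
        have hends : VanishesAtEnds ν fun ω => B.indicator (fun _ => κ) ω -
            ∫ x, B.indicator (fun _ => κ) x ∂(completed ν) := by
          have hz : ∀ ω, cmEval 1 (B.indicator (fun _ => κ) ω) = 0 := fun ω => by
            by_cases hω : ω ∈ B
            · simp [hω, hκ1]
            · rw [Set.indicator_of_notMem hω, map_zero]
          refine .of_forall fun ω => ⟨cmPath_zero _, ?_⟩
          rw [← cmEval_apply, map_sub, hz, cmEval_integral_eq_zero hint hz, sub_zero]
        have had : IsAdaptedL2 ν fun ω => B.indicator (fun _ => κ) ω -
            ∫ x, B.indicator (fun _ => κ) x ∂(completed ν) :=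
          ⟨memLp_sub_integral hk.memLp, measurable_cmPath_sub_const hk.adapted _⟩
        rw [← h _ had hends (by rw [integral_sub hint (integrable_const _)]; simp),
          differential_eq_pairing hS hξ.memLp hgrad had hends, pairing]
    exact ⟨N, _, ⟨hN, hr, hl⟩, (Lp.stronglyMeasurable _).measurable, Lp.memLp _, hae⟩
  · rintro ⟨N, A, hN, -, hA, hae⟩ h hh hends hmean
    rw [differential_eq_pairing hS hξ.memLp hgrad hh hends]
    exact integral_inner_eq_zero_of_martingale hξ.memLp hN.martingale hN.rightContinuous hA hae
      hh.memLp hh.adapted (hends.mono fun _ h => h.2) hmean
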